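/- For an $n$-dimensional smooth semi-Riemannian manifold $(M,g)$ let $R$, $S$, $\kappa$ be the Riemann–Christoffel curvature tensor, $R(X,Y,Z,W)=g(\nabla_X\nabla_YZ-\nabla_Y\nabla_XZ-\nabla_{[X,Y]}Z,W)$, the Ricci tensor $S(Y,Z)=\operatorname{tr}(X\mapsto R(X,Y)Z)$ and the scalar curvature. For $(0,2)$-tensors $A,E$ put $$(A\wedge E)(X_1,X_2,Y_1,Y_2)=A(X_1,Y_2)E(X_2,Y_1)+A(X_2,Y_1)E(X_1,Y_2)-A(X_1,Y_1)E(X_2,Y_2)-A(X_2,Y_2)E(X_1,Y_1).$$ We say that $(M,g)$ is - *conformally flat* if $n\le 2$, or if $n\ge 3$ and the conformal curvature tensor $C=R-\frac1{n-2}\,g\wedge S+\frac{\kappa}{2(n-1)(n-2)}\,g\wedge g$ vanishes identically; - *of constant curvature* if $R=c\cdot\frac12\, g\wedge g$ for a constant $c\in\mathbb R$; - *Einstein* if $S=\frac{\kappa}{n}g$; - *of quasi-constant curvature* if $R=a\,g\wedge g+b\,g\wedge(\eta\otimes\eta)$ for some smooth functions $a,b$ and some smooth $1$-form $\eta$ on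 $M$; - *quasi-Einstein* if $S=\alpha\, g+\beta\,\eta\otimes\eta$ for some smooth functions $\alpha,\beta$ and some smooth $1$-form $\eta$ on $M$. Quasi-constant curvature (quasi-Einstein) *in the strict sense* means in addition that $b$ (resp. $\beta$) and $\eta$ can be chosen to vanish nowhere. Let $(\overline M,\overline g)$ and $(\widetilde M,\widetilde g)$ be connected smooth semi-Riemannian manifolds of dimensions $p\ge1$ and $q\ge1$ with $n=p+q\ge3$, let $f$ be a positive smooth function on $\overline M$, and let $M=\overline M\times_f\widetilde M$ be the warped product, i.e. $\overline M\times\widetilde M$ with the metric $g=\pi^*\overline g+(f\circ\pi)\,\sigma^*\widetilde g$, where $\pi,\sigma$ are the projections to $\overline M$, $\widetilde M$. Write $\overline S$ for the Ricci tensor of the base $\overline M$ and let $$T=-\frac1{2f}\Big(\overline\nabla df-\frac1{2f}\,df\otimes df\Big)$$ on $\overline M$. Suppose that $M$ is conformally flat. Then: (i) the fiber $\widetilde M$ is conformally flat; (ii) unless $(p,q)=(1,2)$, the fiber is of constant curvature if and only if it is Einstein; (iii) the fiber is of quasi-constant curvature if and only if it is quasi-Einstein; if $q\ge3$, the same equivalence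 holds in the strict sense; (iv) if there are functions $a,b,c$ on $\overline M$ with $aT+b\,\overline g+c\,\overline S=0$ and $a(x)\neq0$ for all $x\in\overline M$, then the base $\overline M$ is conformally flat. -/

import Mathlib

set_option maxSynthPendingDepth 3

open scoped Manifold ContDiff

noncomputable section

namespace WarpedGeometry

/-! ### Curvature of a metric on an open subset of a vector space

`G : E → E →L[ℝ] E →L[ℝ] ℝ` is a field of bilinear forms on the finite-dimensional vector space
`E` (the expression of a metric in a chart), and `u : E` is a point. -/

section Local

variable {E : Type*} [NormedAddCommGroup E] [NormedSpace ℝ E]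

/-- The Christoffel symbols of the first kind of `G` at `u`, as a trilinear form:
`(v, w, z) ↦ (∂_v G (w, z) + ∂_w G (v, z) - ∂_z G (v, w)) / 2`. -/
def koszul (G : E → E →L[ℝ] E →L[ℝ] ℝ) (u : E) : E →L[ℝ] E →L[ℝ] E →L[ℝ] ℝ :=
  let A : E →L[ℝ] E →L[ℝ] E →L[ℝ] ℝ := fderiv ℝ G u
  let swap : (E →L[ℝ] E →L[ℝ] ℝ) →L[ℝ] (E →L[ℝ] E →L[ℝ] ℝ) :=
    (ContinuousLinearMap.flipₗᵢ ℝ E E ℝ).toContinuousLinearEquiv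
  let A' : E →L[ℝ] E →L[ℝ] E →L[ℝ] ℝ := swap ∘L A.flip
  (1 / 2 : ℝ) • (A + A.flip + (-1 : ℝ) • A')

theorem koszul_apply (G : E → E →L[ℝ] E →L[ℝ] ℝ) (u v w z : E) :
    koszul G u v w z =
      (fderiv ℝ G u v w z + fderiv ℝ G u w v z - fderiv ℝ G u z v w) / 2 := by
  simp [koszul]
  ring

/-- The Christoffel symbols of the second kind of `G` at `u`, as the `E`-valued bilinear map
`(v, w) ↦ v^j w^k Γ^i_{jk} e_i`: the last index of `koszul G u` is raised with `G u`. -/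
def christoffel (G : E → E →L[ℝ] E →L[ℝ] ℝ) (u : E) : E →L[ℝ] E →L[ℝ] E :=
  (ContinuousLinearMap.compL ℝ E (E →L[ℝ] ℝ) E (G u).inverse) ∘L koszul G u

/-- The defining (Koszul) formula for the Christoffel symbols. -/
theorem christoffel_apply (G : E → E →L[ℝ] E →L[ℝ] ℝ) (u v w z : E)
    (hG : (G u).IsInvertible) :
    G u (christoffel G u v w) z =
      (fderiv ℝ G u v w z + fderiv ℝ G u w v z - fderiv ℝ G u z v w) / 2 := by
  obtain ⟨e, he⟩ := hG
  have key : ∀ l : E →L[ℝ] ℝ, G u ((G u).inverse l) = l := by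
    intro l
    rw [← he, ContinuousLinearMap.inverse_equiv]
    simp
  rw [← koszul_apply, christoffel, ContinuousLinearMap.comp_apply,
    ContinuousLinearMap.compL_apply, ContinuousLinearMap.comp_apply, key]

/-- The curvature operator `R(v, w) z = ∇_v ∇_w z - ∇_w ∇_v z - ∇_{[v, w]} z` of the Levi-Civita
connection of `G`, at `u`, written with the Christoffel symbols. -/
def curvatureOperator (G : E → E →L[ℝ] E →L[ℝ] ℝ) (u v w z : E) : E :=
  fderiv ℝ (christoffel G) u v w z - fderiv ℝ (christoffel G) u w v z
    + christoffel G u v (christoffel G u w z) - christoffel G u w (christoffel G u v z)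

/-- The Riemann-Christoffel curvature tensor `R(v, w, y, z) = G(R(v, w) y, z)` of `G` at `u`. -/
def localRiemann (G : E → E →L[ℝ] E →L[ℝ] ℝ) (u v w y z : E) : ℝ :=
  G u (curvatureOperator G u v w y) z

/-- The Ricci tensor `S(w, z) = tr (v ↦ R(v, w) z)` of `G` at `u`. -/
def localRicci (G : E → E →L[ℝ] E →L[ℝ] ℝ) (u : E) : E →ₗ[ℝ] E →ₗ[ℝ] ℝ :=
  LinearMap.mk₂ ℝ
    (fun w z => LinearMap.trace ℝ E
      { toFun := fun v => curvatureOperator G u v w z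
        map_add' := by intro a b; simp [curvatureOperator]; abel
        map_smul' := by intro c a; simp [curvatureOperator, smul_sub, smul_add] })
    (by
      intro a b z
      rw [← map_add]; congr 1; ext v
      simp [curvatureOperator]; abel)
    (by
      intro c a z
      rw [← map_smul]; congr 1; ext v
      simp [curvatureOperator, smul_sub, smul_add])
    (by
      intro a b z
      rw [← map_add]; congr 1; ext v
      simp [curvatureOperator]; abel)
    (by
      intro c a z
      rw [← map_smul]; congr 1; ext v
      simp [curvatureOperator, smul_sub, smul_add])

/-- The scalar curvature of `G` at `u`: the trace of the Ricci operator `𝒮`, which is defined by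
`G (𝒮 v) w = S(v, w)`. -/
def localScalar [FiniteDimensional ℝ E] (G : E → E →L[ℝ] E →L[ℝ] ℝ) (u : E) : ℝ :=
  LinearMap.trace ℝ E
    ((G u).inverse.toLinearMap ∘ₗ
      (LinearMap.toContinuousLinearMap (𝕜 := ℝ) (E := E) (F' := ℝ)).toLinearMap ∘ₗ
      localRicci G u)

/-- The Kulkarni-Nomizu product of two `(0,2)`-tensors. -/
def kulkarniNomizu {V : Type*} (A B : V → V → ℝ) (x₁ x₂ y₁ y₂ : V) : ℝ :=
  A x₁ y₂ * B x₂ y₁ + A x₂ y₁ * B x₁ y₂ - A x₁ y₁ * B x₂ y₂ - A x₂ y₂ * B x₁ y₁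

end Local

/-! ### Semi-Riemannian manifolds

All manifolds are without boundary (in the uses below the model `I` is boundaryless).  A tensor
at the point `x` is computed in the preferred chart at `x`, through which the tangent space
`TangentSpace I x` is identified with the model space `E`. -/

section Manifold

variable {E : Type*} [NormedAddCommGroup E] [NormedSpace ℝ E]
  {H : Type*} [TopologicalSpace H] (I : ModelWithCorners ℝ E H)
  {M : Type*} [TopologicalSpace M] [ChartedSpace H M]

variable (M) in
/-- A field of bilinear forms on the tangent spaces of `M`. -/
abbrev BilinField : Type _ :=
  ∀ x : M, TangentSpace I x →L[ℝ] TangentSpace I x →L[ℝ] ℝ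

variable (M) in
/-- A field of linear forms on the tangent spaces of `M`. -/
abbrev OneForm : Type _ := ∀ x : M, TangentSpace I x →L[ℝ] ℝ

/-- A smooth, symmetric and nondegenerate field of bilinear forms. -/
structure IsSemiRiemannianMetric [IsManifold I ∞ M] (g : BilinField I M) : Prop where
  symm : ∀ (x : M) (v w : TangentSpace I x), g x v w = g x w v
  nondegenerate : ∀ (x : M) (v : TangentSpace I x), (∀ w, g x v w = 0) → v = 0
  contMDiff : ContMDiff I (I.prod 𝓘(ℝ, E →L[ℝ] E →L[ℝ] ℝ)) ∞
    (fun x => Bundle.TotalSpace.mk' (E →L[ℝ] E →L[ℝ] ℝ)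
      (E := fun x : M => TangentSpace I x →L[ℝ] TangentSpace I x →L[ℝ] ℝ) x (g x))

/-- Smoothness of a `1`-form. -/
def OneForm.IsSmooth [IsManifold I ∞ M] (η : OneForm I M) : Prop :=
  ContMDiff I (I.prod 𝓘(ℝ, E →L[ℝ] ℝ)) ∞
    (fun x => Bundle.TotalSpace.mk' (E →L[ℝ] ℝ)
      (E := fun x : M => TangentSpace I x →L[ℝ] ℝ) x (η x))

/-- The expression of `g` in the preferred chart at `x₀`, i.e. the pullback of `g` under the
inverse of this chart. -/
def inChart (g : BilinField I M) (x₀ : M) (u : E) : E →L[ℝ] E →L[ℝ] ℝ :=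
  let b : E →L[ℝ] E →L[ℝ] ℝ := g ((extChartAt I x₀).symm u)
  let D : E →L[ℝ] E := mfderiv 𝓘(ℝ, E) I (extChartAt I x₀).symm u
  b.bilinearComp D D

/-- The Riemann-Christoffel curvature tensor `R(v, w, y, z) = g(R(v, w) y, z)`; at the point `x`
the expression of `g` in the preferred chart at `x` is `g x` itself. -/
def riemann (g : BilinField I M) (x : M) (v w y z : TangentSpace I x) : ℝ :=
  localRiemann (E := E) (inChart I g x) (extChartAt I x x) v w y z

/-- The Ricci tensor. -/
def ricci (g : BilinField I M) (x : M) (v w : TangentSpace I x) : ℝ :=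
  localRicci (E := E) (inChart I g x) (extChartAt I x x) v w

/-- The scalar curvature. -/
def scalarCurvature [FiniteDimensional ℝ E] (g : BilinField I M) (x : M) : ℝ :=
  localScalar (E := E) (inChart I g x) (extChartAt I x x)

/-- The metric as a function of two vectors. -/
def metricFn (g : BilinField I M) (x : M) (v w : TangentSpace I x) : ℝ := g x v w

/-- The conformal curvature tensor
`C = R - (1/(n-2)) g ∧ S + (κ/(2(n-1)(n-2))) g ∧ g`, for `n = dim M ≥ 3`. -/
def conformalCurvature [FiniteDimensional ℝ E] (g : BilinField I M) (x : M)
    (v w y z : TangentSpace I x) : ℝ :=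
  riemann I g x v w y z
    - 1 / ((Module.finrank ℝ E : ℝ) - 2)
      * kulkarniNomizu (metricFn I g x) (ricci I g x) v w y z
    + scalarCurvature I g x
        / (2 * ((Module.finrank ℝ E : ℝ) - 1) * ((Module.finrank ℝ E : ℝ) - 2))
      * kulkarniNomizu (metricFn I g x) (metricFn I g x) v w y z

/-- `(M, g)` is conformally flat: the conformal curvature tensor vanishes.  That tensor only exists
in dimension at least `3`; every metric on a manifold of dimension at most `2` is conformally
flat. -/
def IsConformallyFlat [FiniteDimensional ℝ E] (g : BilinField I M) : Prop :=
  3 ≤ Module.finrank ℝ E →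
    ∀ (x : M) (v w y z : TangentSpace I x), conformalCurvature I g x v w y z = 0

/-- `(M, g)` has constant curvature: `R = c G` with a constant `c`, where `G = (1/2) g ∧ g`. -/
def IsConstantCurvature (g : BilinField I M) : Prop :=
  ∃ c : ℝ, ∀ (x : M) (v w y z : TangentSpace I x),
    riemann I g x v w y z =
      c * (1 / 2 * kulkarniNomizu (metricFn I g x) (metricFn I g x) v w y z)

/-- `(M, g)` is Einstein: `S = (κ/n) g`. -/
def IsEinstein [FiniteDimensional ℝ E] (g : BilinField I M) : Prop :=
  ∀ (x : M) (v w : TangentSpace I x),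
    ricci I g x v w = scalarCurvature I g x / (Module.finrank ℝ E : ℝ) * g x v w

/-- The tensor square `η ⊗ η` of a `1`-form. -/
def tensorSquare (η : OneForm I M) (x : M) (v w : TangentSpace I x) : ℝ := η x v * η x w

/-- `R = a g ∧ g + b g ∧ (η ⊗ η)`. -/
def QuasiConstantCurvatureEq (g : BilinField I M) (a b : M → ℝ) (η : OneForm I M) : Prop :=
  ∀ (x : M) (v w y z : TangentSpace I x),
    riemann I g x v w y z =
      a x * kulkarniNomizu (metricFn I g x) (metricFn I g x) v w y z
      + b x * kulkarniNomizu (metricFn I g x) (tensorSquare I η x) v w y z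

/-- `S = α g + β η ⊗ η`. -/
def QuasiEinsteinEq (g : BilinField I M) (α β : M → ℝ) (η : OneForm I M) : Prop :=
  ∀ (x : M) (v w : TangentSpace I x),
    ricci I g x v w = α x * g x v w + β x * tensorSquare I η x v w

/-- `(M, g)` is of quasi-constant curvature: `R = a g ∧ g + b g ∧ (η ⊗ η)` with smooth functions
`a`, `b` and a smooth `1`-form `η` (manifolds of constant curvature are included). -/
def IsQuasiConstantCurvature [IsManifold I ∞ M] (g : BilinField I M) : Prop :=
  ∃ (a b : M → ℝ) (η : OneForm I M), ContMDiff I 𝓘(ℝ, ℝ) ∞ a ∧ ContMDiff I 𝓘(ℝ, ℝ) ∞ b ∧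
    OneForm.IsSmooth I η ∧ QuasiConstantCurvatureEq I g a b η

/-- `(M, g)` is quasi-Einstein: `S = α g + β η ⊗ η` with smooth functions `α`, `β` and a smooth
`1`-form `η` (Einstein manifolds are included). -/
def IsQuasiEinstein [IsManifold I ∞ M] (g : BilinField I M) : Prop :=
  ∃ (α β : M → ℝ) (η : OneForm I M), ContMDiff I 𝓘(ℝ, ℝ) ∞ α ∧ ContMDiff I 𝓘(ℝ, ℝ) ∞ β ∧
    OneForm.IsSmooth I η ∧ QuasiEinsteinEq I g α β η

/-- Quasi-constant curvature in the strict sense: `b` and `η` vanish nowhere. -/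
def IsProperQuasiConstantCurvature [IsManifold I ∞ M] (g : BilinField I M) : Prop :=
  ∃ (a b : M → ℝ) (η : OneForm I M), ContMDiff I 𝓘(ℝ, ℝ) ∞ a ∧ ContMDiff I 𝓘(ℝ, ℝ) ∞ b ∧
    OneForm.IsSmooth I η ∧ (∀ x, b x ≠ 0) ∧ (∀ x, η x ≠ 0) ∧ QuasiConstantCurvatureEq I g a b η

/-- Quasi-Einstein in the strict sense: `β` and `η` vanish nowhere. -/
def IsProperQuasiEinstein [IsManifold I ∞ M] (g : BilinField I M) : Prop :=
  ∃ (α β : M → ℝ) (η : OneForm I M), ContMDiff I 𝓘(ℝ, ℝ) ∞ α ∧ ContMDiff I 𝓘(ℝ, ℝ) ∞ β ∧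
    OneForm.IsSmooth I η ∧ (∀ x, β x ≠ 0) ∧ (∀ x, η x ≠ 0) ∧ QuasiEinsteinEq I g α β η

/-- The differential of a function at `x`, in the preferred chart at `x`. -/
def differential (f : M → ℝ) (x : M) (v : TangentSpace I x) : ℝ :=
  fderiv ℝ (fun u : E => f ((extChartAt I x).symm u)) (extChartAt I x x) v

/-- The Hessian `∇ df (v, w) = v^a w^b (∂_a ∂_b f - Γ^c_{ab} ∂_c f)` of a function at `x`. -/
def hessian (g : BilinField I M) (f : M → ℝ) (x : M) (v w : TangentSpace I x) : ℝ :=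
  fderiv ℝ (fderiv ℝ (fun u : E => f ((extChartAt I x).symm u))) (extChartAt I x x) v w
    - differential I f x (christoffel (E := E) (inChart I g x) (extChartAt I x x) v w)

/-- The tensor `T = -(1/(2f)) (∇ df - (1/(2f)) df ⊗ df)` of the base of a warped product with
warping function `f`. -/
def warpingTensor (g : BilinField I M) (f : M → ℝ) (x : M) (v w : TangentSpace I x) : ℝ :=
  -(1 / (2 * f x)) *
    (hessian I g f x v w - 1 / (2 * f x) * (differential I f x v * differential I f x w))

end Manifold

/-! ### Warped products -/

section Warped

variable {E : Type*} [NormedAddCommGroup E] [NormedSpace ℝ E]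
  {H : Type*} [TopologicalSpace H] (I : ModelWithCorners ℝ E H)
  {B : Type*} [TopologicalSpace B] [ChartedSpace H B]
  {E' : Type*} [NormedAddCommGroup E'] [NormedSpace ℝ E']
  {H' : Type*} [TopologicalSpace H'] (J : ModelWithCorners ℝ E' H')
  {F : Type*} [TopologicalSpace F] [ChartedSpace H' F]

/-- The warped product metric `π^* gB + (f ∘ π) σ^* gF` on `B × F`. -/
def warpedProduct (gB : BilinField I B) (f : B → ℝ) (gF : BilinField J F) :
    BilinField (I.prod J) (B × F) := fun x =>
  let bB : E →L[ℝ] E →L[ℝ] ℝ := gB x.1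
  let bF : E' →L[ℝ] E' →L[ℝ] ℝ := gF x.2
  let dπ : E × E' →L[ℝ] E := mfderiv (I.prod J) I Prod.fst x
  let dσ : E × E' →L[ℝ] E' := mfderiv (I.prod J) J Prod.snd x
  bB.bilinearComp dπ dπ + f x.1 • bF.bilinearComp dσ dσ

end Warped

end WarpedGeometry

end

noncomputable section

namespace WarpedGeometry

/-! ### Derivatives of operator-valued maps applied to moving arguments -/

section Calculus

variable {E : Type*} [NormedAddCommGroup E] [NormedSpace ℝ E]
  {V : Type*} [NormedAddCommGroup V] [NormedSpace ℝ V]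
  {W : Type*} [NormedAddCommGroup W] [NormedSpace ℝ W]
  {X : Type*} [NormedAddCommGroup X] [NormedSpace ℝ X]

/-! In dimension n ≥ 3, C = 0 means that at each point R = g ∧ A for some bilinear form A. If C = 0,
the Schouten tensor is such an A. Conversely, traces of R = g ∧ A give S = (n-2)A + (tr A)g and κ =
2(n-1) tr A, and then C cancels. Conformal flatness enters only in this algebraic form.

Write G = ½ g ∧ g, with bars for the base and tildes for the fiber. The Christoffel symbols of a
warped product show that its base components of curvature are R̄, its fiber components are f(R̃ -
νG̃) with ν = |df|²/(4f), and its mixed components are τ(x,z) g̃(v,w) with τ = fT. Comparison of the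
mixed components with g ∧ A forces A = σ g̃ on fiber vectors and fA = τ - σ ḡ on base vectors.
Substituted into the other components this gives R̃ = (ν + 2σ)G̃ and f R̄ = ḡ ∧ (τ - σ ḡ); see
`IsLocalWarpedProduct.exists_of_kulkarniNomizu`.

The second identity yields (iv). By the first, the fiber has pointwise constant curvature ρ, which
gives (i) and makes both sides of the plain equivalence in (iii) true. For (ii), ρ has to be
constant. If q ≥ 3 this is Schur's lemma. If q = 2 and p ≥ 2, the second identity at a fixed base
point determines σ, because Ḡ ≠ 0. If q = 1 the curvature is zero. The strict equivalence follows by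
converting the decomposition of S into one of R, and back, with the same η.

Curvature at a point is defined in the preferred chart of that point, whereas Schur's lemma
differentiates ρ within one chart. Naturality of curvature under chart transitions
(`localRiemann_inChart`) connects the two. -/

theorem fderiv_clm_apply_apply {A : E → V →L[ℝ] W} {s : E → V} {u : E}
    (hA : DifferentiableAt ℝ A u) (hs : DifferentiableAt ℝ s u) (x : E) :
    fderiv ℝ (fun u => A u (s u)) u x = fderiv ℝ A u x (s u) + A u (fderiv ℝ s u x) := by
  rw [fderiv_clm_apply hA hs]
  simp [add_comm]

theorem fderiv_clm_apply₂ {A : E → V →L[ℝ] W →L[ℝ] X} {s : E → V} {t : E → W} {u : E}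
    (hA : DifferentiableAt ℝ A u) (hs : DifferentiableAt ℝ s u) (ht : DifferentiableAt ℝ t u)
    (x : E) :
    fderiv ℝ (fun u => A u (s u) (t u)) u x =
      fderiv ℝ A u x (s u) (t u) + A u (fderiv ℝ s u x) (t u) + A u (s u) (fderiv ℝ t u x) := by
  rw [fderiv_clm_apply_apply (hA.clm_apply hs) ht, fderiv_clm_apply_apply hA hs]
  simp

theorem fderiv_clm_apply_const {A : E → V →L[ℝ] W} {u : E} (hA : DifferentiableAt ℝ A u)
    (v : V) (x : E) : fderiv ℝ (fun u => A u v) u x = fderiv ℝ A u x v := by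
  rw [fderiv_clm_apply_apply hA (differentiableAt_const v)]
  simp

theorem fderiv_clm_apply_const₂ {A : E → V →L[ℝ] W →L[ℝ] X} {u : E}
    (hA : DifferentiableAt ℝ A u) (v : V) (w : W) (x : E) :
    fderiv ℝ (fun u => A u v w) u x = fderiv ℝ A u x v w := by
  rw [fderiv_clm_apply₂ hA (differentiableAt_const v) (differentiableAt_const w)]
  simp

end Calculus

/-! ### Levi-Civita calculus of a metric on an open set -/

section LocalMetric

variable {E : Type*} [NormedAddCommGroup E] [NormedSpace ℝ E]

/-- `G` is a smooth semi-Riemannian metric on the open set `U`. -/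
structure IsMetricOn (G : E → E →L[ℝ] E →L[ℝ] ℝ) (U : Set E) : Prop where
  isOpen : IsOpen U
  contDiffAt : ∀ u ∈ U, ContDiffAt ℝ ∞ G u
  symm : ∀ u ∈ U, ∀ v w, G u v w = G u w v
  invertible : ∀ u ∈ U, (G u).IsInvertible

variable {G : E → E →L[ℝ] E →L[ℝ] ℝ} {U : Set E} {u : E}

theorem eq_of_isInvertible {b : E →L[ℝ] E →L[ℝ] ℝ} (hb : b.IsInvertible) {s t : E}
    (h : ∀ z, b s z = b t z) : s = t := by
  obtain ⟨e, rfl⟩ := hb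
  exact e.injective (ContinuousLinearMap.ext h)

theorem apply_inverse_of_isInvertible {b : E →L[ℝ] E →L[ℝ] ℝ} (hb : b.IsInvertible)
    (l : E →L[ℝ] ℝ) : b (b.inverse l) = l := by
  obtain ⟨e, rfl⟩ := hb
  simp

theorem contDiffAt_koszul (hG : ContDiffAt ℝ ∞ G u) : ContDiffAt ℝ ∞ (koszul G) u := by
  have hA : ContDiffAt ℝ ∞ (fderiv ℝ G) u := hG.fderiv_right (by simp)
  have hF : ContDiffAt ℝ ∞ (fun u => (fderiv ℝ G u).flip) u :=
    (ContinuousLinearMap.flipₗᵢ ℝ E E (E →L[ℝ] ℝ)).toContinuousLinearEquiv.contDiff.contDiffAt.comp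
      u hA
  have hS : ContDiffAt ℝ ∞ (fun u =>
      (((ContinuousLinearMap.flipₗᵢ ℝ E E ℝ).toContinuousLinearEquiv :
        (E →L[ℝ] E →L[ℝ] ℝ) →L[ℝ] (E →L[ℝ] E →L[ℝ] ℝ)) ∘L (fderiv ℝ G u).flip)) u :=
    contDiffAt_const.clm_comp hF
  exact ((hA.add hF).add (hS.const_smul (-1 : ℝ))).const_smul (1 / 2 : ℝ)

namespace IsMetricOn

theorem mem_nhds (h : IsMetricOn G U) (hu : u ∈ U) : U ∈ nhds u := h.isOpen.mem_nhds hu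

theorem differentiableAt (h : IsMetricOn G U) (hu : u ∈ U) : DifferentiableAt ℝ G u :=
  (h.contDiffAt u hu).differentiableAt (by simp)

theorem fderiv_symm (h : IsMetricOn G U) (hu : u ∈ U) (x v w : E) :
    fderiv ℝ G u x v w = fderiv ℝ G u x w v := by
  rw [← fderiv_clm_apply_const₂ (h.differentiableAt hu),
    ← fderiv_clm_apply_const₂ (h.differentiableAt hu)]
  have : (fun u => G u v w) =ᶠ[nhds u] fun u => G u w v := by
    filter_upwards [h.mem_nhds hu] with y hy using h.symm y hy v w
  rw [this.fderiv_eq]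

/-- Nondegeneracy makes the Koszul formula a characterisation, so Christoffel symbols can be found
by verifying a candidate. -/
theorem christoffel_eq (h : IsMetricOn G U) (hu : u ∈ U) {v w t : E}
    (ht : ∀ z, G u t z =
      (fderiv ℝ G u v w z + fderiv ℝ G u w v z - fderiv ℝ G u z v w) / 2) :
    christoffel G u v w = t :=
  eq_of_isInvertible (h.invertible u hu) fun z => by
    rw [ht, christoffel_apply G u v w z (h.invertible u hu)]

theorem christoffel_symm (h : IsMetricOn G U) (hu : u ∈ U) (v w : E) :
    christoffel G u v w = christoffel G u w v :=
  h.christoffel_eq hu fun z => by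
    rw [christoffel_apply G u w v z (h.invertible u hu), h.fderiv_symm hu z]
    ring

theorem metric_compatible (h : IsMetricOn G U) (hu : u ∈ U) (x v w : E) :
    fderiv ℝ G u x v w = G u (christoffel G u x v) w + G u v (christoffel G u x w) := by
  rw [h.symm u hu v, christoffel_apply G u x v w (h.invertible u hu),
    christoffel_apply G u x w v (h.invertible u hu), h.fderiv_symm hu x w v,
    h.fderiv_symm hu v x w, h.fderiv_symm hu w x v]
  ring

variable [FiniteDimensional ℝ E]

theorem contDiffAt_inverse (h : IsMetricOn G U) (hu : u ∈ U) :
    ContDiffAt ℝ ∞ (fun u => (G u).inverse) u :=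
  have : CompleteSpace E := FiniteDimensional.complete ℝ E
  (h.invertible u hu).contDiffAt_map_inverse.comp u (h.contDiffAt u hu)

theorem contDiffAt_christoffel (h : IsMetricOn G U) (hu : u ∈ U) :
    ContDiffAt ℝ ∞ (christoffel G) u :=
  ((ContinuousLinearMap.compL ℝ E (E →L[ℝ] ℝ) E).contDiff.contDiffAt.comp u
    (h.contDiffAt_inverse hu)).clm_comp (contDiffAt_koszul (h.contDiffAt u hu))

theorem differentiableAt_christoffel (h : IsMetricOn G U) (hu : u ∈ U) :
    DifferentiableAt ℝ (christoffel G) u :=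
  (h.contDiffAt_christoffel hu).differentiableAt (by simp)

theorem contDiffAt_fderiv_christoffel (h : IsMetricOn G U) (hu : u ∈ U) :
    ContDiffAt ℝ ∞ (fderiv ℝ (christoffel G)) u :=
  (h.contDiffAt_christoffel hu).fderiv_right (by simp)

theorem contDiffAt_curvatureOperator (h : IsMetricOn G U) (hu : u ∈ U) (v w z : E) :
    ContDiffAt ℝ ∞ (fun u => curvatureOperator G u v w z) u := by
  have h1 := h.contDiffAt_fderiv_christoffel hu
  have h0 := h.contDiffAt_christoffel hu
  have c : ∀ x : E, ContDiffAt ℝ ∞ (fun _ : E => x) u := fun x => contDiffAt_const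
  exact (((((h1.clm_apply (c v)).clm_apply (c w)).clm_apply (c z)).sub
    (((h1.clm_apply (c w)).clm_apply (c v)).clm_apply (c z))).add
    ((h0.clm_apply (c v)).clm_apply ((h0.clm_apply (c w)).clm_apply (c z)))).sub
    ((h0.clm_apply (c w)).clm_apply ((h0.clm_apply (c v)).clm_apply (c z)))

theorem contDiffAt_localRiemann (h : IsMetricOn G U) (hu : u ∈ U) (v w y z : E) :
    ContDiffAt ℝ ∞ (fun u => localRiemann G u v w y z) u :=
  ((h.contDiffAt u hu).clm_apply (h.contDiffAt_curvatureOperator hu v w y)).clm_apply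
    contDiffAt_const

/-- The derivative of the curvature operator, for constant arguments. -/
theorem fderiv_curvatureOperator (h : IsMetricOn G U) (hu : u ∈ U) (x v w z : E) :
    fderiv ℝ (fun u => curvatureOperator G u v w z) u x =
      fderiv ℝ (fderiv ℝ (christoffel G)) u x v w z
      - fderiv ℝ (fderiv ℝ (christoffel G)) u x w v z
      + (fderiv ℝ (christoffel G) u x v (christoffel G u w z)
        + christoffel G u v (fderiv ℝ (christoffel G) u x w z))
      - (fderiv ℝ (christoffel G) u x w (christoffel G u v z)
        + christoffel G u w (fderiv ℝ (christoffel G) u x v z)) := by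
  have h1 : DifferentiableAt ℝ (fderiv ℝ (christoffel G)) u :=
    (h.contDiffAt_fderiv_christoffel hu).differentiableAt (by simp)
  have h0 := h.differentiableAt_christoffel hu
  have c : ∀ x : E, DifferentiableAt ℝ (fun _ : E => x) u := fun x => differentiableAt_const x
  have d1 : ∀ v w, DifferentiableAt ℝ (fun u => fderiv ℝ (christoffel G) u v w z) u :=
    fun v w => ((h1.clm_apply (c v)).clm_apply (c w)).clm_apply (c z)
  have d0 : ∀ v, DifferentiableAt ℝ (fun u => christoffel G u v) u := fun v => h0.clm_apply (c v)
  have d00 : ∀ v, DifferentiableAt ℝ (fun u => christoffel G u v z) u :=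
    fun v => (d0 v).clm_apply (c z)
  have d2 : ∀ v w, DifferentiableAt ℝ (fun u => christoffel G u v (christoffel G u w z)) u :=
    fun v w => (d0 v).clm_apply (d00 w)
  have e1 : ∀ v w, fderiv ℝ (fun u => fderiv ℝ (christoffel G) u v w z) u x =
      fderiv ℝ (fderiv ℝ (christoffel G)) u x v w z := fun v w => by
    rw [fderiv_clm_apply_const ((h1.clm_apply (c v)).clm_apply (c w)),
      fderiv_clm_apply_const₂ h1]
  have e2 : ∀ v w, fderiv ℝ (fun u => christoffel G u v (christoffel G u w z)) u x =
      fderiv ℝ (christoffel G) u x v (christoffel G u w z)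
        + christoffel G u v (fderiv ℝ (christoffel G) u x w z) := fun v w => by
    rw [fderiv_clm_apply_apply (d0 v) (d00 w), fderiv_clm_apply_const h0,
      fderiv_clm_apply_const₂ h0]
  unfold curvatureOperator
  rw [fderiv_fun_sub (((d1 v w).fun_sub (d1 w v)).fun_add (d2 v w)) (d2 w v),
    fderiv_fun_add ((d1 v w).fun_sub (d1 w v)) (d2 v w), fderiv_fun_sub (d1 v w) (d1 w v)]
  simp only [sub_apply, add_apply, e1, e2]

/-- The second Bianchi identity. -/
theorem bianchi (h : IsMetricOn G U) (hu : u ∈ U) (x v w z : E) :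
    (fderiv ℝ (fun u => curvatureOperator G u v w z) u x
        + christoffel G u x (curvatureOperator G u v w z)
        - curvatureOperator G u v w (christoffel G u x z))
      + (fderiv ℝ (fun u => curvatureOperator G u w x z) u v
        + christoffel G u v (curvatureOperator G u w x z)
        - curvatureOperator G u w x (christoffel G u v z))
      + (fderiv ℝ (fun u => curvatureOperator G u x v z) u w
        + christoffel G u w (curvatureOperator G u x v z)
        - curvatureOperator G u x v (christoffel G u w z)) = 0 := by
  -- Symmetry of the second derivative of Γ cancels the terms of highest order. The corrections of
  -- ∇R in the arguments v and w do not appear in the statement: they cancel in the cyclic sum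
  -- because Γ is symmetric.
  have hs : IsSymmSndFDerivAt ℝ (christoffel G) u :=
    (h.contDiffAt_christoffel hu).isSymmSndFDerivAt
      (by simpa using WithTop.coe_le_coe.2 (le_top : (2 : ℕ∞) ≤ ⊤))
  rw [h.fderiv_curvatureOperator hu, h.fderiv_curvatureOperator hu,
    h.fderiv_curvatureOperator hu, hs x v, hs w x, hs v w]
  simp only [curvatureOperator, map_add, map_sub]
  abel

end IsMetricOn

end LocalMetric

/-! ### Naturality of the curvature under local isometries -/

section Pullback

variable {E : Type*} [NormedAddCommGroup E] [NormedSpace ℝ E] [FiniteDimensional ℝ E]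
  {G G' : E → E →L[ℝ] E →L[ℝ] ℝ} {U U' : Set E} {φ : E → E} {u : E}

/-- `φ` pulls the metric `G` on `U` back to the metric `G'` on `U'`. -/
structure IsLocalIsometryOn (φ : E → E) (G' : E → E →L[ℝ] E →L[ℝ] ℝ) (U' : Set E)
    (G : E → E →L[ℝ] E →L[ℝ] ℝ) (U : Set E) : Prop where
  source : IsMetricOn G' U'
  target : IsMetricOn G U
  contDiffAt : ∀ u ∈ U', ContDiffAt ℝ ∞ φ u
  mapsTo : ∀ u ∈ U', φ u ∈ U
  pullback : ∀ u ∈ U', ∀ v w, G' u v w = G (φ u) (fderiv ℝ φ u v) (fderiv ℝ φ u w)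

namespace IsLocalIsometryOn

/-- A vector killed by dφ is G'-orthogonal to everything, hence zero; equality of dimensions does
the rest. -/
theorem surjective (h : IsLocalIsometryOn φ G' U' G U) (hu : u ∈ U') :
    Function.Surjective (fderiv ℝ φ u) := by
  have hinj : Function.Injective (fderiv ℝ φ u : E →ₗ[ℝ] E) := by
    rw [← LinearMap.ker_eq_bot, LinearMap.ker_eq_bot']
    intro v hv
    refine eq_of_isInvertible (h.source.invertible u hu) fun z => ?_
    have hv' : fderiv ℝ φ u v = 0 := hv
    simp [h.pullback u hu, hv']
  exact LinearMap.surjective_of_injective hinj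

/-- Differentiating the pullback identity produces two terms with D²φ for each derivative of G'. In
the Koszul combination the symmetry of D²φ and of G leaves only the one paired with dφ z, and such
vectors exhaust the space. -/
theorem christoffel_pullback (h : IsLocalIsometryOn φ G' U' G U) (hu : u ∈ U') (v w : E) :
    fderiv ℝ φ u (christoffel G' u v w) =
      christoffel G (φ u) (fderiv ℝ φ u v) (fderiv ℝ φ u w)
        + fderiv ℝ (fderiv ℝ φ) u v w := by
  have hφ := h.contDiffAt u hu
  have hs : IsSymmSndFDerivAt ℝ φ u :=
    hφ.isSymmSndFDerivAt (by simpa using WithTop.coe_le_coe.2 (le_top : (2 : ℕ∞) ≤ ⊤))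
  have hd : DifferentiableAt ℝ φ u := hφ.differentiableAt (by simp)
  have hdd : DifferentiableAt ℝ (fderiv ℝ φ) u :=
    (hφ.fderiv_right (m := ∞) (by simp)).differentiableAt (by simp)
  have hGφ : DifferentiableAt ℝ (fun u => G (φ u)) u :=
    (h.target.differentiableAt (h.mapsTo u hu)).comp u hd
  have hd' : ∀ v : E, DifferentiableAt ℝ (fun u => fderiv ℝ φ u v) u :=
    fun v => hdd.clm_apply (differentiableAt_const v)
  have key : ∀ x v w, fderiv ℝ G' u x v w =
      fderiv ℝ G (φ u) (fderiv ℝ φ u x) (fderiv ℝ φ u v) (fderiv ℝ φ u w)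
      + G (φ u) (fderiv ℝ (fderiv ℝ φ) u x v) (fderiv ℝ φ u w)
      + G (φ u) (fderiv ℝ φ u v) (fderiv ℝ (fderiv ℝ φ) u x w) := by
    intro x v w
    have e : (fun u => G' u v w) =ᶠ[nhds u]
        fun u => G (φ u) (fderiv ℝ φ u v) (fderiv ℝ φ u w) := by
      filter_upwards [h.source.mem_nhds hu] with y hy using h.pullback y hy v w
    have e1 : fderiv ℝ (fun u => G (φ u)) u x = fderiv ℝ G (φ u) (fderiv ℝ φ u x) := by
      rw [show (fun u => G (φ u)) = G ∘ φ from rfl,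
        fderiv_comp u (h.target.differentiableAt (h.mapsTo u hu)) hd]
      rfl
    rw [← fderiv_clm_apply_const₂ (h.source.differentiableAt hu), e.fderiv_eq,
      fderiv_clm_apply₂ hGφ (hd' v) (hd' w), e1, fderiv_clm_apply_const hdd,
      fderiv_clm_apply_const hdd]
  refine eq_of_isInvertible (h.target.invertible _ (h.mapsTo u hu)) fun z => ?_
  obtain ⟨z, rfl⟩ := h.surjective hu z
  rw [← h.pullback u hu, christoffel_apply G' u v w z (h.source.invertible u hu), map_add,
    add_apply, christoffel_apply G _ _ _ _ (h.target.invertible _ (h.mapsTo u hu)),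
    key, key, key, hs w v, hs z v, hs z w,
    h.target.symm _ (h.mapsTo u hu) (fderiv ℝ φ u w),
    h.target.symm _ (h.mapsTo u hu) (fderiv ℝ φ u v) (fderiv ℝ (fderiv ℝ φ) u w z)]
  ring

/-- Local isometries preserve the curvature operator. -/
theorem curvatureOperator_pullback (h : IsLocalIsometryOn φ G' U' G U) (hu : u ∈ U')
    (v w z : E) :
    fderiv ℝ φ u (curvatureOperator G' u v w z) =
      curvatureOperator G (φ u) (fderiv ℝ φ u v) (fderiv ℝ φ u w) (fderiv ℝ φ u z) := by
  have hφ := h.contDiffAt u hu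
  have hd : DifferentiableAt ℝ φ u := hφ.differentiableAt (by simp)
  have hφ' : ContDiffAt ℝ ∞ (fderiv ℝ φ) u := hφ.fderiv_right (by simp)
  have hdd : DifferentiableAt ℝ (fderiv ℝ φ) u := hφ'.differentiableAt (by simp)
  have hddd : DifferentiableAt ℝ (fderiv ℝ (fderiv ℝ φ)) u :=
    (hφ'.fderiv_right (m := ∞) (by simp)).differentiableAt (by simp)
  have hs : IsSymmSndFDerivAt ℝ (fderiv ℝ φ) u :=
    hφ'.isSymmSndFDerivAt (by simpa using WithTop.coe_le_coe.2 (le_top : (2 : ℕ∞) ≤ ⊤))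
  have hΓ := h.target.differentiableAt_christoffel (h.mapsTo u hu)
  have hΓφ : DifferentiableAt ℝ (fun u => christoffel G (φ u)) u := hΓ.comp u hd
  have hΓ' := h.source.differentiableAt_christoffel hu
  have hd' : ∀ v : E, DifferentiableAt ℝ (fun u => fderiv ℝ φ u v) u :=
    fun v => hdd.clm_apply (differentiableAt_const v)
  have c : ∀ v : E, DifferentiableAt ℝ (fun _ : E => v) u := fun v => differentiableAt_const v
  have e1 : ∀ x, fderiv ℝ (fun u => christoffel G (φ u)) u x =
      fderiv ℝ (christoffel G) (φ u) (fderiv ℝ φ u x) := fun x => by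
    rw [show (fun u => christoffel G (φ u)) = christoffel G ∘ φ from rfl, fderiv_comp u hΓ hd]
    rfl
  -- This is the derivative of the transformation law. After antisymmetrisation in x and w, the D³φ
  -- terms cancel by symmetry and the D²φ terms cancel against those from the quadratic part of the
  -- curvature.
  have key : ∀ x w, fderiv ℝ φ u (fderiv ℝ (christoffel G') u x w z) =
      fderiv ℝ (christoffel G) (φ u) (fderiv ℝ φ u x) (fderiv ℝ φ u w) (fderiv ℝ φ u z)
      + christoffel G (φ u) (fderiv ℝ (fderiv ℝ φ) u x w) (fderiv ℝ φ u z)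
      + christoffel G (φ u) (fderiv ℝ φ u w) (fderiv ℝ (fderiv ℝ φ) u x z)
      + fderiv ℝ (fderiv ℝ (fderiv ℝ φ)) u x w z
      - fderiv ℝ (fderiv ℝ φ) u x (christoffel G' u w z) := by
    intro x w
    have e : (fun u => fderiv ℝ φ u (christoffel G' u w z)) =ᶠ[nhds u]
        fun u => christoffel G (φ u) (fderiv ℝ φ u w) (fderiv ℝ φ u z)
          + fderiv ℝ (fderiv ℝ φ) u w z := by
      filter_upwards [h.source.mem_nhds hu] with y hy using h.christoffel_pullback hy w z
    have e2 := congrArg (fun l : E →L[ℝ] E => l x) e.fderiv_eq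
    beta_reduce at e2
    rw [fderiv_fun_add ((hΓφ.clm_apply (hd' w)).clm_apply (hd' z))
        ((hddd.clm_apply (c w)).clm_apply (c z)), add_apply,
      fderiv_clm_apply_apply hdd ((hΓ'.clm_apply (c w)).clm_apply (c z)),
      fderiv_clm_apply_const₂ hΓ', fderiv_clm_apply₂ hΓφ (hd' w) (hd' z), e1,
      fderiv_clm_apply_const hdd, fderiv_clm_apply_const hdd, fderiv_clm_apply_const₂ hddd] at e2
    rw [← e2]
    abel
  simp only [curvatureOperator, map_add, map_sub, key, h.christoffel_pullback hu, hs w v]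
  rw [show fderiv ℝ (fderiv ℝ φ) u w v = fderiv ℝ (fderiv ℝ φ) u v w from
    hφ.isSymmSndFDerivAt (by simpa using WithTop.coe_le_coe.2 (le_top : (2 : ℕ∞) ≤ ⊤)) w v]
  abel

theorem localRiemann_pullback (h : IsLocalIsometryOn φ G' U' G U) (hu : u ∈ U')
    (v w y z : E) :
    localRiemann G' u v w y z =
      localRiemann G (φ u) (fderiv ℝ φ u v) (fderiv ℝ φ u w) (fderiv ℝ φ u y)
        (fderiv ℝ φ u z) := by
  rw [localRiemann, h.pullback u hu, h.curvatureOperator_pullback hu]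
  rfl

end IsLocalIsometryOn

end Pullback

/-! ### Metric traces, and the Ricci and scalar curvature of R = g ∧ A -/

section Trace

variable {E : Type*} [NormedAddCommGroup E] [NormedSpace ℝ E]

/-- A continuous bilinear form as a bilinear form. -/
def toBilin (b : E →L[ℝ] E →L[ℝ] ℝ) : E →ₗ[ℝ] E →ₗ[ℝ] ℝ :=
  LinearMap.mk₂ ℝ (fun v w => b v w) (by simp) (by simp) (by simp) (by simp)

@[simp] theorem toBilin_apply (b : E →L[ℝ] E →L[ℝ] ℝ) (v w : E) : toBilin b v w = b v w := rfl

variable [FiniteDimensional ℝ E]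

/-- The trace of the endomorphism obtained from a bilinear form `A` by raising an index with
`b`. -/
def metricTrace (b : E →L[ℝ] E →L[ℝ] ℝ) (A : E →ₗ[ℝ] E →ₗ[ℝ] ℝ) : ℝ :=
  LinearMap.trace ℝ E (b.inverse.toLinearMap ∘ₗ
    (LinearMap.toContinuousLinearMap (𝕜 := ℝ) (E := E) (F' := ℝ)).toLinearMap ∘ₗ A)

theorem metricTrace_add (b : E →L[ℝ] E →L[ℝ] ℝ) (A A' : E →ₗ[ℝ] E →ₗ[ℝ] ℝ) :
    metricTrace b (A + A') = metricTrace b A + metricTrace b A' := by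
  simp [metricTrace, LinearMap.comp_add]

theorem metricTrace_smul (b : E →L[ℝ] E →L[ℝ] ℝ) (c : ℝ) (A : E →ₗ[ℝ] E →ₗ[ℝ] ℝ) :
    metricTrace b (c • A) = c * metricTrace b A := by
  simp [metricTrace, LinearMap.comp_smul]

theorem metricTrace_self {b : E →L[ℝ] E →L[ℝ] ℝ} (hb : b.IsInvertible) :
    metricTrace b (toBilin b) = Module.finrank ℝ E := by
  rw [metricTrace, ← LinearMap.trace_id ℝ E]
  congr 1
  ext v
  refine eq_of_isInvertible hb fun z => ?_
  simp only [LinearMap.comp_apply, ContinuousLinearMap.coe_coe, LinearMap.id_apply]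
  rw [apply_inverse_of_isInvertible hb]
  rfl

variable {G : E → E →L[ℝ] E →L[ℝ] ℝ} {u : E}

/-- The Ricci tensor of a metric with `R = g ∧ A`. -/
theorem localRicci_of_kulkarniNomizu
    (hG : (G u).IsInvertible) (A : E →ₗ[ℝ] E →ₗ[ℝ] ℝ)
    (hR : ∀ v w y z, localRiemann G u v w y z =
      kulkarniNomizu (fun v w => G u v w) (fun v w => A v w) v w y z) :
    localRicci G u = ((Module.finrank ℝ E : ℝ) - 2) • A + metricTrace (G u) A • toBilin (G u) := by
  set S : E →ₗ[ℝ] E := (G u).inverse.toLinearMap ∘ₗ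
    (LinearMap.toContinuousLinearMap (𝕜 := ℝ) (E := E) (F' := ℝ)).toLinearMap ∘ₗ A with hS
  have hSA : ∀ v z, G u (S v) z = A v z := by
    intro v z
    simp only [hS, LinearMap.comp_apply, ContinuousLinearMap.coe_coe]
    rw [apply_inverse_of_isInvertible hG]
    rfl
  have hop : ∀ v w y, curvatureOperator G u v w y =
      A w y • v + G u w y • S v - G u v y • S w - A v y • w := by
    intro v w y
    refine eq_of_isInvertible hG fun z => ?_
    have := hR v w y z
    simp only [localRiemann, kulkarniNomizu] at this
    rw [this]
    simp only [map_add, map_sub, map_smul, add_apply, sub_apply, smul_apply,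
      smul_eq_mul, hSA]
    ring
  ext w y
  -- As a map of v, the curvature operator is a multiple of the identity, plus a multiple of the
  -- endomorphism S of A, minus two maps of rank at most one. Their traces are n A(w,y), (tr A)
  -- g(w,y), and A(w,y) twice; hence the factor n - 2.
  have hmap : ∀ L : E →ₗ[ℝ] E, (∀ v, L v = curvatureOperator G u v w y) →
      L = A w y • LinearMap.id + G u w y • S - ((toBilin (G u)).flip y).smulRight (S w)
        - (A.flip y).smulRight w := by
    intro L hL
    ext v
    rw [hL, hop]
    simp
  have : localRicci G u w y = LinearMap.trace ℝ E (A w y • LinearMap.id + G u w y • S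
      - ((toBilin (G u)).flip y).smulRight (S w) - (A.flip y).smulRight w) :=
    congrArg (LinearMap.trace ℝ E) (hmap _ fun v => rfl)
  rw [this, map_sub, map_sub, map_add, map_smul, map_smul, LinearMap.trace_smulRight,
    LinearMap.trace_smulRight, LinearMap.trace_id]
  simp only [LinearMap.flip_apply, toBilin_apply, hSA, LinearMap.add_apply, LinearMap.smul_apply,
    smul_eq_mul]
  rw [show LinearMap.trace ℝ E S = metricTrace (G u) A from rfl]
  ring

theorem localScalar_eq_metricTrace : localScalar G u = metricTrace (G u) (localRicci G u) := rfl

/-- The scalar curvature of a metric with `R = g ∧ A`. -/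
theorem localScalar_of_kulkarniNomizu
    (hG : (G u).IsInvertible) (A : E →ₗ[ℝ] E →ₗ[ℝ] ℝ)
    (hR : ∀ v w y z, localRiemann G u v w y z =
      kulkarniNomizu (fun v w => G u v w) (fun v w => A v w) v w y z) :
    localScalar G u = 2 * ((Module.finrank ℝ E : ℝ) - 1) * metricTrace (G u) A := by
  rw [localScalar_eq_metricTrace, localRicci_of_kulkarniNomizu hG A hR, metricTrace_add,
    metricTrace_smul, metricTrace_smul, metricTrace_self hG]
  ring

end Trace

/-! ### Schur's lemma in infinitesimal form -/

section Schur

variable {E : Type*} [NormedAddCommGroup E] [NormedSpace ℝ E] [FiniteDimensional ℝ E]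
  {G : E → E →L[ℝ] E →L[ℝ] ℝ} {U : Set E} {u : E}

/-- This is the second Bianchi identity for R = ρ(g(w,z)v - g(v,z)w): since g is parallel and Γ
symmetric, only the derivatives of ρ survive. -/
theorem fderiv_schur {ρ : E → ℝ} (h : IsMetricOn G U) (hu : u ∈ U)
    (hρ : DifferentiableAt ℝ ρ u)
    (hR : ∀ u ∈ U, ∀ v w z, curvatureOperator G u v w z = ρ u • (G u w z • v - G u v z • w))
    (x v w z : E) :
    fderiv ℝ ρ u x • (G u w z • v - G u v z • w)
      + fderiv ℝ ρ u v • (G u x z • w - G u w z • x)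
      + fderiv ℝ ρ u w • (G u v z • x - G u x z • v) = 0 := by
  have c : ∀ v : E, DifferentiableAt ℝ (fun _ : E => v) u := fun v => differentiableAt_const v
  have hg : ∀ v w, DifferentiableAt ℝ (fun u => G u v w) u :=
    fun v w => ((h.differentiableAt hu).clm_apply (c v)).clm_apply (c w)
  have hd : ∀ x v w, fderiv ℝ (fun u => curvatureOperator G u v w z) u x =
      fderiv ℝ ρ u x • (G u w z • v - G u v z • w)
      + ρ u • (fderiv ℝ G u x w z • v - fderiv ℝ G u x v z • w) := by
    intro x v w
    have e : (fun u => curvatureOperator G u v w z) =ᶠ[nhds u]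
        fun u => ρ u • (G u w z • v - G u v z • w) := by
      filter_upwards [h.mem_nhds hu] with y hy using hR y hy v w z
    rw [e.fderiv_eq, fderiv_fun_smul hρ (((hg w z).fun_smul (c v)).fun_sub ((hg v z).fun_smul (c w))),
      fderiv_fun_sub ((hg w z).fun_smul (c v)) ((hg v z).fun_smul (c w)),
      fderiv_fun_smul (hg w z) (c v), fderiv_fun_smul (hg v z) (c w)]
    simp [fderiv_clm_apply_const₂ (h.differentiableAt hu), add_comm]
  have hb := h.bianchi hu x v w z
  simp only [hd, h.metric_compatible hu, hR u hu, map_sub, map_smul] at hb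
  rw [h.christoffel_symm hu v x, h.christoffel_symm hu w x, h.christoffel_symm hu w v] at hb
  rw [← hb]
  module

/-- The infinitesimal form of Schur's lemma. -/
theorem fderiv_eq_zero_of_pointwise_constant {ρ : E → ℝ} (hn : 3 ≤ Module.finrank ℝ E)
    (h : IsMetricOn G U) (hu : u ∈ U) (hρ : DifferentiableAt ℝ ρ u)
    (hR : ∀ u ∈ U, ∀ v w z, curvatureOperator G u v w z = ρ u • (G u w z • v - G u v z • w)) :
    fderiv ℝ ρ u = 0 := by
  have hn' : (3 : ℝ) ≤ Module.finrank ℝ E := by exact_mod_cast hn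
  -- The trace over v of the Bianchi relation is n - 2 times the difference of the two sides; this
  -- is where n ≥ 3 matters.
  have h1 : ∀ x w z, fderiv ℝ ρ u x * G u w z = fderiv ℝ ρ u w * G u x z := by
    intro x w z
    have hmap : fderiv ℝ ρ u x • (G u w z • LinearMap.id - ((toBilin (G u)).flip z).smulRight w)
        + ((G u x z • (fderiv ℝ ρ u).toLinearMap.smulRight w)
          - (G u w z) • (fderiv ℝ ρ u).toLinearMap.smulRight x)
        + fderiv ℝ ρ u w • (((toBilin (G u)).flip z).smulRight x - G u x z • LinearMap.id) =
        (0 : E →ₗ[ℝ] E) := by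
      ext v
      have := fderiv_schur h hu hρ hR x v w z
      rw [smul_sub (fderiv ℝ ρ u v), smul_comm (fderiv ℝ ρ u v),
        smul_comm (fderiv ℝ ρ u v)] at this
      simpa using this
    have ht := congrArg (LinearMap.trace ℝ E) hmap
    simp only [map_add, map_sub, map_smul, LinearMap.trace_smulRight, LinearMap.trace_id,
      LinearMap.flip_apply, toBilin_apply, smul_eq_mul, map_zero,
      ContinuousLinearMap.coe_coe] at ht
    have h2 : ((Module.finrank ℝ E : ℝ) - 2) *
        (fderiv ℝ ρ u x * G u w z - fderiv ℝ ρ u w * G u x z) = 0 := by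
      rw [← ht]
      ring
    have h3 := (mul_eq_zero.1 h2).resolve_left (by linarith)
    linarith
  ext x
  -- With z removed by nondegeneracy, a second trace, over w, gives n dρ(x) = dρ(x).
  have h4 : ∀ w, fderiv ℝ ρ u x • w = fderiv ℝ ρ u w • x := fun w =>
    eq_of_isInvertible (h.invertible u hu) fun z => by simpa using h1 x w z
  have ht : fderiv ℝ ρ u x • LinearMap.id = (fderiv ℝ ρ u).toLinearMap.smulRight x :=
    LinearMap.ext fun w => by simpa using h4 w
  have ht' := congrArg (LinearMap.trace ℝ E) ht
  simp only [map_smul, LinearMap.trace_smulRight, LinearMap.trace_id, smul_eq_mul,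
    ContinuousLinearMap.coe_coe] at ht'
  have h5 : fderiv ℝ ρ u x * ((Module.finrank ℝ E : ℝ) - 1) = 0 := by linarith
  simpa using (mul_eq_zero.1 h5).resolve_right (by linarith)

end Schur

theorem isInvertible_of_nondegenerate {E : Type*} [NormedAddCommGroup E] [NormedSpace ℝ E]
    [FiniteDimensional ℝ E] {b : E →L[ℝ] E →L[ℝ] ℝ}
    (hb : ∀ v, (∀ w, b v w = 0) → v = 0) : b.IsInvertible := by
  have hinj : Function.Injective (b : E →ₗ[ℝ] E →L[ℝ] ℝ) := by
    rw [← LinearMap.ker_eq_bot, LinearMap.ker_eq_bot']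
    intro v hv
    refine hb v fun w => ?_
    have hv' : b v = 0 := hv
    simp [hv']
  have hdim : Module.finrank ℝ E = Module.finrank ℝ (E →L[ℝ] ℝ) := by
    rw [← (LinearMap.toContinuousLinearMap (𝕜 := ℝ) (E := E) (F' := ℝ)).finrank_eq]
    exact (Subspace.dual_finrank_eq (K := ℝ) (V := E)).symm
  refine ⟨(LinearEquiv.ofInjectiveOfFinrankEq b.toLinearMap hinj hdim).toContinuousLinearEquiv, ?_⟩
  ext v w
  rfl

/-! ### Functions of one factor of a product -/

section Product

variable {E : Type*} [NormedAddCommGroup E] [NormedSpace ℝ E]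
  {E' : Type*} [NormedAddCommGroup E'] [NormedSpace ℝ E']
  {V : Type*} [NormedAddCommGroup V] [NormedSpace ℝ V] {p : E × E'}

theorem fderiv_fun_fst {k : E → V} (hk : DifferentiableAt ℝ k p.1) (X : E × E') :
    fderiv ℝ (fun p : E × E' => k p.1) p X = fderiv ℝ k p.1 X.1 := by
  have := (hk.hasFDerivAt.comp p (hasFDerivAt_fst (𝕜 := ℝ) (p := p))).fderiv
  rw [show (fun p : E × E' => k p.1) = k ∘ Prod.fst from rfl, this]
  rfl

theorem fderiv_fun_snd {k : E' → V} (hk : DifferentiableAt ℝ k p.2) (X : E × E') :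
    fderiv ℝ (fun p : E × E' => k p.2) p X = fderiv ℝ k p.2 X.2 := by
  have := (hk.hasFDerivAt.comp p (hasFDerivAt_snd (𝕜 := ℝ) (p := p))).fderiv
  rw [show (fun p : E × E' => k p.2) = k ∘ Prod.snd from rfl, this]
  rfl

end Product

/-! ### Christoffel symbols and curvature of a local warped product -/

section LocalWarped

variable {E : Type*} [NormedAddCommGroup E] [NormedSpace ℝ E]
  {E' : Type*} [NormedAddCommGroup E'] [NormedSpace ℝ E']

/-- On `U × U'` the metric `G` is the warped product of `GB` and `GF` with warping function
`h`. -/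
structure IsLocalWarpedProduct (GB : E → E →L[ℝ] E →L[ℝ] ℝ) (U : Set E) (h : E → ℝ)
    (GF : E' → E' →L[ℝ] E' →L[ℝ] ℝ) (U' : Set E')
    (G : E × E' → E × E' →L[ℝ] E × E' →L[ℝ] ℝ) : Prop where
  base : IsMetricOn GB U
  fiber : IsMetricOn GF U'
  contDiffAt_warp : ∀ u ∈ U, ContDiffAt ℝ ∞ h u
  warp_ne_zero : ∀ u ∈ U, h u ≠ 0
  eq : ∀ p ∈ U ×ˢ U', ∀ V W, G p V W = GB p.1 V.1 W.1 + h p.1 * GF p.2 V.2 W.2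

/-- Half the gradient of the warping function. -/
def warpGradient (GB : E → E →L[ℝ] E →L[ℝ] ℝ) (h : E → ℝ) (u : E) : E :=
  (1 / 2 : ℝ) • (GB u).inverse (fderiv ℝ h u)

/-- Half the logarithmic differential of the warping function. -/
def warpForm (h : E → ℝ) (u : E) : E →L[ℝ] ℝ := (2 * h u)⁻¹ • fderiv ℝ h u

namespace IsLocalWarpedProduct

variable {GB : E → E →L[ℝ] E →L[ℝ] ℝ} {U : Set E} {h : E → ℝ}
  {GF : E' → E' →L[ℝ] E' →L[ℝ] ℝ} {U' : Set E'}
  {G : E × E' → E × E' →L[ℝ] E × E' →L[ℝ] ℝ} {p : E × E'}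

theorem differentiableAt_warp (H : IsLocalWarpedProduct GB U h GF U' G) {u : E} (hu : u ∈ U) :
    DifferentiableAt ℝ h u := (H.contDiffAt_warp u hu).differentiableAt (by simp)

theorem differentiableAt_fderiv_warp (H : IsLocalWarpedProduct GB U h GF U' G) {u : E}
    (hu : u ∈ U) : DifferentiableAt ℝ (fderiv ℝ h) u :=
  ((H.contDiffAt_warp u hu).fderiv_right (m := ∞) (by simp)).differentiableAt (by simp)

theorem differentiableAt_warpForm (H : IsLocalWarpedProduct GB U h GF U' G) {u : E}
    (hu : u ∈ U) : DifferentiableAt ℝ (warpForm h) u :=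
  (((H.differentiableAt_warp hu).const_mul 2).inv
    (mul_ne_zero two_ne_zero (H.warp_ne_zero u hu))).smul (H.differentiableAt_fderiv_warp hu)

variable [FiniteDimensional ℝ E]

theorem differentiableAt_warpGradient (H : IsLocalWarpedProduct GB U h GF U' G) {u : E}
    (hu : u ∈ U) : DifferentiableAt ℝ (warpGradient GB h) u :=
  (((H.base.contDiffAt_inverse hu).differentiableAt (by simp)).clm_apply
    (H.differentiableAt_fderiv_warp hu)).const_smul (1 / 2 : ℝ)

variable [FiniteDimensional ℝ E']

theorem isMetricOn (H : IsLocalWarpedProduct GB U h GF U' G) : IsMetricOn G (U ×ˢ U') where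
  isOpen := H.base.isOpen.prod H.fiber.isOpen
  contDiffAt := by
    have hopen := H.base.isOpen.prod H.fiber.isOpen
    have hc : ContDiffOn ℝ ∞ G (U ×ˢ U') := by
      refine contDiffOn_clm_apply.2 fun V => contDiffOn_clm_apply.2 fun W => ?_
      have e : ∀ p ∈ U ×ˢ U', G p V W = GB p.1 V.1 W.1 + h p.1 * GF p.2 V.2 W.2 :=
        fun p hp => H.eq p hp V W
      refine ContDiffOn.congr (fun p hp => ContDiffAt.contDiffWithinAt ?_) e
      have hB := (H.base.contDiffAt p.1 hp.1).comp p contDiffAt_fst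
      have hF := (H.fiber.contDiffAt p.2 hp.2).comp p contDiffAt_snd
      have hh := (H.contDiffAt_warp p.1 hp.1).comp p contDiffAt_fst
      exact ((hB.clm_apply contDiffAt_const).clm_apply contDiffAt_const).add
        (hh.mul ((hF.clm_apply contDiffAt_const).clm_apply contDiffAt_const))
    exact fun p hp => hc.contDiffAt (hopen.mem_nhds hp)
  symm p hp V W := by
    rw [H.eq p hp, H.eq p hp, H.base.symm _ hp.1, H.fiber.symm _ hp.2]
  invertible p hp := by
    refine isInvertible_of_nondegenerate fun V hV => ?_
    refine Prod.ext (eq_of_isInvertible (H.base.invertible _ hp.1) fun z => ?_)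
      (eq_of_isInvertible (H.fiber.invertible _ hp.2) fun z => ?_)
    · simpa [H.eq p hp] using hV (z, 0)
    · simpa [H.eq p hp, H.warp_ne_zero _ hp.1] using hV (0, z)

theorem fderiv_eq (H : IsLocalWarpedProduct GB U h GF U' G) (hp : p ∈ U ×ˢ U')
    (X V W : E × E') :
    fderiv ℝ G p X V W = fderiv ℝ GB p.1 X.1 V.1 W.1
      + (fderiv ℝ h p.1 X.1 * GF p.2 V.2 W.2 + h p.1 * fderiv ℝ GF p.2 X.2 V.2 W.2) := by
  have hB := H.base.differentiableAt hp.1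
  have hF := H.fiber.differentiableAt hp.2
  have hh := H.differentiableAt_warp hp.1
  have e : (fun p => G p V W) =ᶠ[nhds p]
      fun p => GB p.1 V.1 W.1 + h p.1 * GF p.2 V.2 W.2 := by
    filter_upwards [H.isMetricOn.mem_nhds hp] with y hy using H.eq y hy V W
  have dB : DifferentiableAt ℝ (fun u => GB u V.1 W.1) p.1 :=
    (hB.clm_apply (differentiableAt_const _)).clm_apply (differentiableAt_const _)
  have dF : DifferentiableAt ℝ (fun u => GF u V.2 W.2) p.2 :=
    (hF.clm_apply (differentiableAt_const _)).clm_apply (differentiableAt_const _)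
  have dB' : DifferentiableAt ℝ (fun p : E × E' => GB p.1 V.1 W.1) p := dB.comp p differentiableAt_fst
  have dF' : DifferentiableAt ℝ (fun p : E × E' => GF p.2 V.2 W.2) p := dF.comp p differentiableAt_snd
  have dh' : DifferentiableAt ℝ (fun p : E × E' => h p.1) p := hh.comp p differentiableAt_fst
  rw [← fderiv_clm_apply_const₂ (H.isMetricOn.differentiableAt hp), e.fderiv_eq,
    fderiv_fun_add dB' (dh'.fun_mul dF'), fderiv_fun_mul dh' dF']
  simp only [add_apply, smul_apply, smul_eq_mul, fderiv_fun_fst dB, fderiv_fun_snd dF,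
    fderiv_fun_fst hh, fderiv_clm_apply_const₂ hB, fderiv_clm_apply_const₂ hF]
  ring

/-- The Christoffel symbols of a warped product. -/
theorem christoffel_eq (H : IsLocalWarpedProduct GB U h GF U' G) (hp : p ∈ U ×ˢ U')
    (V W : E × E') :
    christoffel G p V W =
      (christoffel GB p.1 V.1 W.1 - GF p.2 V.2 W.2 • warpGradient GB h p.1,
        christoffel GF p.2 V.2 W.2 + (warpForm h p.1 V.1 • W.2 + warpForm h p.1 W.1 • V.2)) := by
  -- In the Koszul formula, -½ dh(Z₁) gF(V₂,W₂) is represented by half the gradient of h. The terms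
  -- ½ dh(V₁) gF(W₂,Z₂) and ½ dh(W₁) gF(V₂,Z₂) are represented with a factor 1/(2h), because the
  -- fiber metric is scaled by h.
  refine H.isMetricOn.christoffel_eq hp fun Z => ?_
  have h0 := H.warp_ne_zero _ hp.1
  rw [H.eq p hp, H.fderiv_eq hp, H.fderiv_eq hp, H.fderiv_eq hp]
  simp only [map_add, map_sub, map_smul, add_apply, sub_apply, smul_apply, smul_eq_mul,
    warpGradient, warpForm, apply_inverse_of_isInvertible (H.base.invertible _ hp.1),
    christoffel_apply GB _ _ _ _ (H.base.invertible _ hp.1),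
    christoffel_apply GF _ _ _ _ (H.fiber.invertible _ hp.2)]
  field_simp
  ring

theorem fderiv_christoffel_eq (H : IsLocalWarpedProduct GB U h GF U' G) (hp : p ∈ U ×ˢ U')
    (X V W : E × E') :
    fderiv ℝ (christoffel G) p X V W =
      (fderiv ℝ (christoffel GB) p.1 X.1 V.1 W.1
        - (fderiv ℝ GF p.2 X.2 V.2 W.2 • warpGradient GB h p.1
          + GF p.2 V.2 W.2 • fderiv ℝ (warpGradient GB h) p.1 X.1),
        fderiv ℝ (christoffel GF) p.2 X.2 V.2 W.2
          + (fderiv ℝ (warpForm h) p.1 X.1 V.1 • W.2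
            + fderiv ℝ (warpForm h) p.1 X.1 W.1 • V.2)) := by
  have hF := H.fiber.differentiableAt hp.2
  have hΓB := H.base.differentiableAt_christoffel hp.1
  have hΓF := H.fiber.differentiableAt_christoffel hp.2
  have hN := H.differentiableAt_warpGradient hp.1
  have hθ := H.differentiableAt_warpForm hp.1
  have e : (fun p => christoffel G p V W) =ᶠ[nhds p] fun p =>
      (christoffel GB p.1 V.1 W.1 - GF p.2 V.2 W.2 • warpGradient GB h p.1,
        christoffel GF p.2 V.2 W.2
          + (warpForm h p.1 V.1 • W.2 + warpForm h p.1 W.1 • V.2)) := by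
    filter_upwards [H.isMetricOn.mem_nhds hp] with y hy using H.christoffel_eq hy V W
  have d1 : DifferentiableAt ℝ (fun u => christoffel GB u V.1 W.1) p.1 :=
    (hΓB.clm_apply (differentiableAt_const _)).clm_apply (differentiableAt_const _)
  have d2 : DifferentiableAt ℝ (fun u => GF u V.2 W.2) p.2 :=
    (hF.clm_apply (differentiableAt_const _)).clm_apply (differentiableAt_const _)
  have d3 : DifferentiableAt ℝ (fun u => christoffel GF u V.2 W.2) p.2 :=
    (hΓF.clm_apply (differentiableAt_const _)).clm_apply (differentiableAt_const _)
  have d4 : ∀ v, DifferentiableAt ℝ (fun u => warpForm h u v) p.1 :=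
    fun v => hθ.clm_apply (differentiableAt_const _)
  have D1 : DifferentiableAt ℝ (fun p : E × E' => christoffel GB p.1 V.1 W.1) p :=
    d1.comp p differentiableAt_fst
  have D2 : DifferentiableAt ℝ (fun p : E × E' => GF p.2 V.2 W.2) p :=
    d2.comp p differentiableAt_snd
  have D3 : DifferentiableAt ℝ (fun p : E × E' => christoffel GF p.2 V.2 W.2) p :=
    d3.comp p differentiableAt_snd
  have D4 : ∀ v, DifferentiableAt ℝ (fun p : E × E' => warpForm h p.1 v) p :=
    fun v => (d4 v).comp p differentiableAt_fst
  have D5 : DifferentiableAt ℝ (fun p : E × E' => warpGradient GB h p.1) p :=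
    hN.comp p differentiableAt_fst
  have c : ∀ w : E', DifferentiableAt ℝ (fun _ : E × E' => w) p := fun w => differentiableAt_const w
  rw [← fderiv_clm_apply_const₂ (H.isMetricOn.differentiableAt_christoffel hp), e.fderiv_eq,
    DifferentiableAt.fderiv_prodMk (D1.fun_sub (D2.fun_smul D5))
      (D3.fun_add (((D4 V.1).fun_smul (c W.2)).fun_add ((D4 W.1).fun_smul (c V.2)))),
    fderiv_fun_sub D1 (D2.fun_smul D5), fderiv_fun_smul D2 D5,
    fderiv_fun_add D3 (((D4 V.1).fun_smul (c W.2)).fun_add ((D4 W.1).fun_smul (c V.2))),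
    fderiv_fun_add ((D4 V.1).fun_smul (c W.2)) ((D4 W.1).fun_smul (c V.2)),
    fderiv_fun_smul (D4 V.1) (c W.2), fderiv_fun_smul (D4 W.1) (c V.2)]
  simp [fderiv_fun_fst d1, fderiv_fun_snd d2, fderiv_fun_snd d3, fderiv_fun_fst (d4 _),
    fderiv_fun_fst hN, fderiv_clm_apply_const₂ hΓB, fderiv_clm_apply_const₂ hΓF,
    fderiv_clm_apply_const₂ hF, fderiv_clm_apply_const hθ, add_comm]

theorem localRiemann_base (H : IsLocalWarpedProduct GB U h GF U' G) (hp : p ∈ U ×ˢ U')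
    (v w y z : E) :
    localRiemann G p (v, 0) (w, 0) (y, 0) (z, 0) = localRiemann GB p.1 v w y z := by
  simp [localRiemann, curvatureOperator, H.eq p hp, H.christoffel_eq hp,
    H.fderiv_christoffel_eq hp]

/-- The correction to the intrinsic curvature comes from Γ(v, Γ(w, y)) passing through the base:
Γ(w, y) has base component -gF(w,y)N, with N half the gradient of h, and Γ(v, N) = θ(N)v with θ =
dh/(2h). -/
theorem localRiemann_fiber (H : IsLocalWarpedProduct GB U h GF U' G) (hp : p ∈ U ×ˢ U')
    (v w y z : E') :
    localRiemann G p (0, v) (0, w) (0, y) (0, z) = h p.1 * (localRiemann GF p.2 v w y z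
      - warpForm h p.1 (warpGradient GB h p.1)
        * (GF p.2 w y * GF p.2 v z - GF p.2 v y * GF p.2 w z)) := by
  simp [localRiemann, curvatureOperator, H.eq p hp, H.christoffel_eq hp,
    H.fderiv_christoffel_eq hp]
  left
  ring

/-- The mixed components of the curvature of a warped product. -/
theorem localRiemann_mixed (H : IsLocalWarpedProduct GB U h GF U' G) (hp : p ∈ U ×ˢ U')
    (x z : E) (v w : E') :
    localRiemann G p (x, 0) (0, v) (0, w) (z, 0) =
      -GB p.1 (fderiv ℝ (warpGradient GB h) p.1 x + christoffel GB p.1 x (warpGradient GB h p.1)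
        - warpForm h p.1 x • warpGradient GB h p.1) z * GF p.2 v w := by
  simp [localRiemann, curvatureOperator, H.eq p hp, H.christoffel_eq hp,
    H.fderiv_christoffel_eq hp]
  ring

end IsLocalWarpedProduct

end LocalWarped

/-! ### Chart expressions of a metric and their transitions -/

section Chart

variable {E : Type*} [NormedAddCommGroup E] [NormedSpace ℝ E]
  {M : Type*} [TopologicalSpace M] [ChartedSpace E M]

/-- The derivative of the inverse of the preferred chart at `x`, in terms of the preferred charts
at the image points. -/
def chartSymmDeriv (x : M) (u : E) : E →L[ℝ] E :=
  mfderiv 𝓘(ℝ, E) 𝓘(ℝ, E) (extChartAt 𝓘(ℝ, E) x).symm u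

/-- A field of bilinear forms, with the tangent spaces identified with the model space. -/
def modelForm (g : BilinField 𝓘(ℝ, E) M) (x : M) : E →L[ℝ] E →L[ℝ] ℝ := g x

theorem inChart_apply (g : BilinField 𝓘(ℝ, E) M) (x : M) (u v w : E) :
    inChart 𝓘(ℝ, E) g x u v w =
      modelForm g ((extChartAt 𝓘(ℝ, E) x).symm u) (chartSymmDeriv x u v)
        (chartSymmDeriv x u w) := rfl

/-- The transition map from the preferred chart at `x` to the one at `y`. -/
def transition (x y : M) : E → E := extChartAt 𝓘(ℝ, E) y ∘ (extChartAt 𝓘(ℝ, E) x).symm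

/-- The domain of the transition map. -/
def transitionDomain (x y : M) : Set E :=
  (extChartAt 𝓘(ℝ, E) x).target ∩
    (extChartAt 𝓘(ℝ, E) x).symm ⁻¹' (extChartAt 𝓘(ℝ, E) y).source

theorem isOpen_transitionDomain (x y : M) : IsOpen (transitionDomain x y : Set E) :=
  (continuousOn_extChartAt_symm x).isOpen_inter_preimage (isOpen_extChartAt_target x)
    (isOpen_extChartAt_source y)

variable [IsManifold 𝓘(ℝ, E) ∞ M]

theorem mdifferentiableAt_chart_symm {x : M} {u : E} (hu : u ∈ (extChartAt 𝓘(ℝ, E) x).target) :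
    MDifferentiableAt 𝓘(ℝ, E) 𝓘(ℝ, E) (extChartAt 𝓘(ℝ, E) x).symm u := by
  have : IsManifold 𝓘(ℝ, E) 1 M := IsManifold.of_le (n := ∞) (by simp)
  have := mdifferentiableWithinAt_extChartAt_symm hu
  rwa [ModelWithCorners.range_eq_univ, mdifferentiableWithinAt_univ] at this

theorem contMDiffAt_chart_symm {x : M} {u : E} (hu : u ∈ (extChartAt 𝓘(ℝ, E) x).target) :
    ContMDiffAt 𝓘(ℝ, E) 𝓘(ℝ, E) ∞ (extChartAt 𝓘(ℝ, E) x).symm u :=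
  (contMDiffOn_extChartAt_symm x).contMDiffAt ((isOpen_extChartAt_target x).mem_nhds hu)

theorem isInvertible_chartSymmDeriv {x : M} {u : E} (hu : u ∈ (extChartAt 𝓘(ℝ, E) x).target) :
    (chartSymmDeriv x u).IsInvertible := by
  have : IsManifold 𝓘(ℝ, E) 1 M := IsManifold.of_le (n := ∞) (by simp)
  have := isInvertible_mfderivWithin_extChartAt_symm hu
  rwa [ModelWithCorners.range_eq_univ, mfderivWithin_univ] at this

theorem chartSymmDeriv_self (x : M) :
    chartSymmDeriv x (extChartAt 𝓘(ℝ, E) x x) = ContinuousLinearMap.id ℝ E := by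
  have : IsManifold 𝓘(ℝ, E) 1 M := IsManifold.of_le (n := ∞) (by simp)
  have := mfderivWithin_range_extChartAt_symm (I := 𝓘(ℝ, E)) (x := x)
  rwa [ModelWithCorners.range_eq_univ, mfderivWithin_univ] at this

theorem inChart_self (g : BilinField 𝓘(ℝ, E) M) (x : M) :
    inChart 𝓘(ℝ, E) g x (extChartAt 𝓘(ℝ, E) x x) = modelForm g x := by
  ext v w
  rw [inChart_apply, chartSymmDeriv_self, extChartAt_to_inv]
  rfl

theorem contDiffAt_transition {x y : M} {u : E} (hu : u ∈ transitionDomain x y) :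
    ContDiffAt ℝ ∞ (transition x y : E → E) u := by
  refine contMDiffAt_iff_contDiffAt.1 (ContMDiffAt.comp u ?_ (contMDiffAt_chart_symm hu.1))
  have := hu.2
  refine contMDiffAt_extChartAt' ?_
  simpa using this

theorem chartSymmDeriv_transition {x y : M} {u : E} (hu : u ∈ transitionDomain x y) :
    (chartSymmDeriv y (transition x y u)) ∘L (fderiv ℝ (transition x y) u) =
      chartSymmDeriv x u := by
  have hd : DifferentiableAt ℝ (transition x y : E → E) u :=
    (contDiffAt_transition hu).differentiableAt (by simp)
  have hφ := hd.hasFDerivAt.hasMFDerivAt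
  have hmem : transition x y u ∈ (extChartAt 𝓘(ℝ, E) y).target :=
    (extChartAt 𝓘(ℝ, E) y).map_source hu.2
  have hy := (mdifferentiableAt_chart_symm hmem).hasMFDerivAt
  have hc := hy.comp u hφ
  have e : (extChartAt 𝓘(ℝ, E) x).symm =ᶠ[nhds u]
      (extChartAt 𝓘(ℝ, E) y).symm ∘ transition x y := by
    filter_upwards [(isOpen_transitionDomain x y).mem_nhds hu] with t ht
    exact ((extChartAt 𝓘(ℝ, E) y).left_inv ht.2).symm
  exact ((hc.congr_of_eventuallyEq e).mfderiv).symm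

/-- The tangent space at the image point is read in the preferred chart there, and at the centre of
that chart the inverse chart has derivative the identity. -/
theorem fderiv_transition {x : M} {u : E} (hu : u ∈ (extChartAt 𝓘(ℝ, E) x).target) :
    fderiv ℝ (transition x ((extChartAt 𝓘(ℝ, E) x).symm u)) u = chartSymmDeriv x u := by
  have := chartSymmDeriv_transition (x := x) (y := (extChartAt 𝓘(ℝ, E) x).symm u) (u := u)
    ⟨hu, mem_extChartAt_source _⟩
  rw [← this, transition, Function.comp_apply, chartSymmDeriv_self]
  rfl

/-- On constant vectors, the chart expression is the smooth section g paired with two smooth fields,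
the images of constant fields under the tangent map of the inverse chart. -/
theorem contDiffAt_inChart {g : BilinField 𝓘(ℝ, E) M} [FiniteDimensional ℝ E]
    (hg : IsSemiRiemannianMetric 𝓘(ℝ, E) g)
    {x : M} {u : E} (hu : u ∈ (extChartAt 𝓘(ℝ, E) x).target) :
    ContDiffAt ℝ ∞ (inChart 𝓘(ℝ, E) g x) u := by
  have hopen : IsOpen (extChartAt 𝓘(ℝ, E) x).target := isOpen_extChartAt_target x
  refine ContDiffOn.contDiffAt (s := (extChartAt 𝓘(ℝ, E) x).target) ?_ (hopen.mem_nhds hu)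
  refine contDiffOn_clm_apply.2 fun v => contDiffOn_clm_apply.2 fun w => ?_
  have hvec : ∀ v : E, ContMDiffOn 𝓘(ℝ, E) (𝓘(ℝ, E).prod 𝓘(ℝ, E)) ∞
      (fun u => Bundle.TotalSpace.mk' E (E := fun y : M => TangentSpace 𝓘(ℝ, E) y)
        ((extChartAt 𝓘(ℝ, E) x).symm u) (chartSymmDeriv x u v))
      (extChartAt 𝓘(ℝ, E) x).target := by
    intro v
    have h1 : ContMDiffOn 𝓘(ℝ, E) 𝓘(ℝ, E).tangent ∞
        (fun u => (⟨u, v⟩ : TangentBundle 𝓘(ℝ, E) E)) (extChartAt 𝓘(ℝ, E) x).target :=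
      contMDiffOn_vectorSpace_iff_contDiffOn.2 contDiffOn_const
    have h2 := ((contMDiffOn_extChartAt_symm (I := 𝓘(ℝ, E)) (n := ∞) x).contMDiffOn_tangentMapWithin
      (m := ∞) (by simp) hopen.uniqueMDiffOn).comp h1 (fun u hu => hu)
    refine h2.congr fun u hu => ?_
    simp only [Function.comp_apply, tangentMapWithin, mfderivWithin_of_isOpen hopen hu]
    rfl
  intro u hu
  have hb : ContMDiffWithinAt 𝓘(ℝ, E) 𝓘(ℝ, E) ∞ (extChartAt 𝓘(ℝ, E) x).symm
      (extChartAt 𝓘(ℝ, E) x).target u := (contMDiffAt_chart_symm hu).contMDiffWithinAt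
  have : ContMDiffWithinAt 𝓘(ℝ, E) (𝓘(ℝ, E).prod 𝓘(ℝ)) ∞
      (fun u => Bundle.TotalSpace.mk' ℝ (E := Bundle.Trivial M ℝ)
        ((extChartAt 𝓘(ℝ, E) x).symm u)
        (g ((extChartAt 𝓘(ℝ, E) x).symm u) (chartSymmDeriv x u v) (chartSymmDeriv x u w)))
      (extChartAt 𝓘(ℝ, E) x).target u := by
    apply ContMDiffWithinAt.clm_bundle_apply₂ (F₁ := E) (F₂ := E)
    · exact ContMDiffAt.comp_contMDiffWithinAt u hg.contMDiff.contMDiffAt hb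
    · exact hvec v u hu
    · exact hvec w u hu
  simp only [Bundle.contMDiffWithinAt_totalSpace] at this
  exact contMDiffWithinAt_iff_contDiffWithinAt.1 this.2

variable {g : BilinField 𝓘(ℝ, E) M}

theorem modelForm_symm (hg : IsSemiRiemannianMetric 𝓘(ℝ, E) g) (x : M) (v w : E) :
    modelForm g x v w = modelForm g x w v := hg.symm x v w

theorem modelForm_nondegenerate (hg : IsSemiRiemannianMetric 𝓘(ℝ, E) g) (x : M) {v : E}
    (hv : ∀ w, modelForm g x v w = 0) : v = 0 := hg.nondegenerate x v hv

variable [FiniteDimensional ℝ E]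

theorem IsSemiRiemannianMetric.isMetricOn (hg : IsSemiRiemannianMetric 𝓘(ℝ, E) g) (x : M) :
    IsMetricOn (inChart 𝓘(ℝ, E) g x) (extChartAt 𝓘(ℝ, E) x).target where
  isOpen := isOpen_extChartAt_target x
  contDiffAt _ hu := contDiffAt_inChart hg hu
  symm u _ v w := by
    rw [inChart_apply, inChart_apply, modelForm_symm hg]
  invertible u hu := by
    obtain ⟨e, he⟩ := isInvertible_chartSymmDeriv hu
    refine isInvertible_of_nondegenerate fun v hv => e.injective ?_
    rw [map_zero]
    refine modelForm_nondegenerate hg ((extChartAt 𝓘(ℝ, E) x).symm u) fun w => ?_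
    have h1 := hv (e.symm w)
    rw [inChart_apply, ← he] at h1
    simpa using h1

theorem isLocalIsometryOn_transition (hg : IsSemiRiemannianMetric 𝓘(ℝ, E) g) (x y : M) :
    IsLocalIsometryOn (transition x y) (inChart 𝓘(ℝ, E) g x) (transitionDomain x y)
      (inChart 𝓘(ℝ, E) g y) (extChartAt 𝓘(ℝ, E) y).target where
  source := by
    have h := hg.isMetricOn x
    exact ⟨isOpen_transitionDomain x y, fun u hu => h.contDiffAt u hu.1,
      fun u hu => h.symm u hu.1, fun u hu => h.invertible u hu.1⟩
  target := hg.isMetricOn y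
  contDiffAt _ hu := contDiffAt_transition hu
  mapsTo _ hu := (extChartAt 𝓘(ℝ, E) y).map_source hu.2
  pullback u hu v w := by
    rw [inChart_apply, inChart_apply, ← chartSymmDeriv_transition hu, transition,
      Function.comp_apply, (extChartAt 𝓘(ℝ, E) y).left_inv hu.2]
    rfl

/-- The curvature tensor in an arbitrary preferred chart. -/
theorem localRiemann_inChart (hg : IsSemiRiemannianMetric 𝓘(ℝ, E) g) {x : M} {u : E}
    (hu : u ∈ (extChartAt 𝓘(ℝ, E) x).target) (v w y z : E) :
    localRiemann (inChart 𝓘(ℝ, E) g x) u v w y z =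
      riemann 𝓘(ℝ, E) g ((extChartAt 𝓘(ℝ, E) x).symm u) (chartSymmDeriv x u v)
        (chartSymmDeriv x u w) (chartSymmDeriv x u y) (chartSymmDeriv x u z) := by
  rw [(isLocalIsometryOn_transition hg x ((extChartAt 𝓘(ℝ, E) x).symm u)).localRiemann_pullback
    ⟨hu, mem_extChartAt_source _⟩, fderiv_transition hu]
  rfl

end Chart

/-! ### Algebra of curvature tensors proportional to ½ g ∧ g -/

section Algebra

variable {E : Type*} [NormedAddCommGroup E] [NormedSpace ℝ E]

/-- The tensor `G = (1/2) b ∧ b`. -/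
def halfSquare (b : E →L[ℝ] E →L[ℝ] ℝ) (v w y z : E) : ℝ := b v z * b w y - b v y * b w z

theorem kulkarniNomizu_self (b : E →L[ℝ] E →L[ℝ] ℝ) (v w y z : E) :
    kulkarniNomizu (fun v w => b v w) (fun v w => b v w) v w y z = 2 * halfSquare b v w y z := by
  simp only [kulkarniNomizu, halfSquare]
  ring

theorem halfSquare_eq_kulkarniNomizu (b : E →L[ℝ] E →L[ℝ] ℝ) (r : ℝ) (v w y z : E) :
    r * halfSquare b v w y z =
      kulkarniNomizu (fun v w => b v w) (fun v w => ((r / 2) • toBilin b) v w) v w y z := by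
  simp only [kulkarniNomizu, halfSquare, LinearMap.smul_apply, toBilin_apply, smul_eq_mul]
  ring

variable {G : E → E →L[ℝ] E →L[ℝ] ℝ} {u : E}

theorem curvatureOperator_of_halfSquare (hG : (G u).IsInvertible) {r : ℝ}
    (hR : ∀ v w y z, localRiemann G u v w y z = r * halfSquare (G u) v w y z) (v w y : E) :
    curvatureOperator G u v w y = r • (G u w y • v - G u v y • w) :=
  eq_of_isInvertible hG fun z => by
    have := hR v w y z
    rw [localRiemann] at this
    rw [this]
    simp only [halfSquare, map_sub, map_smul, sub_apply, smul_apply, smul_eq_mul]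
    ring

theorem exists_apply_ne_zero (hn : 1 ≤ Module.finrank ℝ E) {b : E →L[ℝ] E →L[ℝ] ℝ}
    (hb : b.IsInvertible) : ∃ v w, b v w ≠ 0 := by
  by_contra! h0
  have : Nontrivial E := Module.nontrivial_of_finrank_pos (R := ℝ) (by omega)
  obtain ⟨w, hw⟩ := exists_ne (0 : E)
  exact hw (eq_of_isInvertible hb fun z => by simp [h0])

variable [FiniteDimensional ℝ E]

theorem halfSquare_eq_zero (hn : Module.finrank ℝ E ≤ 1) (b : E →L[ℝ] E →L[ℝ] ℝ)
    (v w y z : E) : halfSquare b v w y z = 0 := by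
  obtain ⟨e, he⟩ := finrank_le_one_iff.1 hn
  obtain ⟨r, rfl⟩ := he v
  obtain ⟨s, rfl⟩ := he w
  simp [halfSquare]
  ring

/-- Otherwise b(w,y)v = b(v,y)w for all v, and the trace over v gives (n - 1)b = 0. -/
theorem exists_halfSquare_ne_zero (hn : 2 ≤ Module.finrank ℝ E) {b : E →L[ℝ] E →L[ℝ] ℝ}
    (hb : b.IsInvertible) : ∃ v w y z, halfSquare b v w y z ≠ 0 := by
  by_contra! hK
  have hn' : (2 : ℝ) ≤ Module.finrank ℝ E := by exact_mod_cast hn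
  have h0 : ∀ w y, b w y = 0 := by
    intro w y
    have hmap : b w y • LinearMap.id = ((toBilin b).flip y).smulRight w := by
      refine LinearMap.ext fun v => eq_of_isInvertible hb fun z => ?_
      have := hK v w y z
      simp only [halfSquare] at this
      simp
      linarith
    have ht := congrArg (LinearMap.trace ℝ E) hmap
    simp only [map_smul, LinearMap.trace_smulRight, LinearMap.trace_id, smul_eq_mul,
      LinearMap.flip_apply, toBilin_apply] at ht
    have h1 : b w y * ((Module.finrank ℝ E : ℝ) - 1) = 0 := by linarith
    exact (mul_eq_zero.1 h1).resolve_right (by linarith)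
  obtain ⟨w, y, hwy⟩ := exists_apply_ne_zero (by omega) hb
  exact hwy (h0 w y)

theorem localRicci_of_halfSquare (hG : (G u).IsInvertible) {r : ℝ}
    (hR : ∀ v w y z, localRiemann G u v w y z = r * halfSquare (G u) v w y z) (v w : E) :
    localRicci G u v w = ((Module.finrank ℝ E : ℝ) - 1) * r * G u v w := by
  rw [localRicci_of_kulkarniNomizu hG ((r / 2) • toBilin (G u))
    fun v w y z => by rw [hR, halfSquare_eq_kulkarniNomizu]]
  simp only [metricTrace_smul, metricTrace_self hG, LinearMap.add_apply, LinearMap.smul_apply,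
    toBilin_apply, smul_eq_mul]
  ring

theorem localScalar_of_halfSquare (hG : (G u).IsInvertible) {r : ℝ}
    (hR : ∀ v w y z, localRiemann G u v w y z = r * halfSquare (G u) v w y z) :
    localScalar G u = (Module.finrank ℝ E : ℝ) * ((Module.finrank ℝ E : ℝ) - 1) * r := by
  rw [localScalar_of_kulkarniNomizu hG ((r / 2) • toBilin (G u))
    fun v w y z => by rw [hR, halfSquare_eq_kulkarniNomizu], metricTrace_smul, metricTrace_self hG]
  ring

end Algebra

/-! ### Algebraic criterion for conformal flatness -/

section Conformal

variable {E : Type*} [NormedAddCommGroup E] [NormedSpace ℝ E] [FiniteDimensional ℝ E]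
  {M : Type*} [TopologicalSpace M] [ChartedSpace E M] [IsManifold 𝓘(ℝ, E) ∞ M]
  {g : BilinField 𝓘(ℝ, E) M}

theorem isInvertible_inChart_self (hg : IsSemiRiemannianMetric 𝓘(ℝ, E) g) (x : M) :
    (inChart 𝓘(ℝ, E) g x (extChartAt 𝓘(ℝ, E) x x)).IsInvertible :=
  (hg.isMetricOn x).invertible _ (mem_extChartAt_target x)

/-- A metric whose curvature tensor is a product `g ∧ A` is conformally flat. -/
theorem isConformallyFlat_of_kulkarniNomizu (hg : IsSemiRiemannianMetric 𝓘(ℝ, E) g)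
    (h : ∀ x : M, ∃ A : E →ₗ[ℝ] E →ₗ[ℝ] ℝ, ∀ v w y z : E,
      riemann 𝓘(ℝ, E) g x v w y z =
        kulkarniNomizu (fun v w => modelForm g x v w) (fun v w => A v w) v w y z) :
    IsConformallyFlat 𝓘(ℝ, E) g := by
  intro hn x v w y z
  have hn' : (3 : ℝ) ≤ Module.finrank ℝ E := by exact_mod_cast hn
  obtain ⟨A, hA⟩ := h x
  rw [← inChart_self] at hA
  have hG := isInvertible_inChart_self hg x
  have hric : ∀ v w : E,
      localRicci (inChart 𝓘(ℝ, E) g x) (extChartAt 𝓘(ℝ, E) x x) v w =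
        ((Module.finrank ℝ E : ℝ) - 2) * A v w
          + metricTrace (inChart 𝓘(ℝ, E) g x (extChartAt 𝓘(ℝ, E) x x)) A * modelForm g x v w := by
    intro v w
    rw [localRicci_of_kulkarniNomizu hG A hA, ← inChart_self]
    rfl
  have hscal := localScalar_of_kulkarniNomizu hG A hA
  rw [inChart_self] at hA
  -- With t = tr A, the Ricci term contributes -g ∧ A - t/(n-2) g ∧ g and the scalar term + t/(n-2)
  -- g ∧ g.
  have key : ∀ v w y z : E, riemann 𝓘(ℝ, E) g x v w y z
      - 1 / ((Module.finrank ℝ E : ℝ) - 2) * kulkarniNomizu (fun v w => modelForm g x v w)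
        (fun v w => localRicci (inChart 𝓘(ℝ, E) g x) (extChartAt 𝓘(ℝ, E) x x) v w) v w y z
      + localScalar (inChart 𝓘(ℝ, E) g x) (extChartAt 𝓘(ℝ, E) x x)
        / (2 * ((Module.finrank ℝ E : ℝ) - 1) * ((Module.finrank ℝ E : ℝ) - 2))
        * kulkarniNomizu (fun v w => modelForm g x v w) (fun v w => modelForm g x v w)
          v w y z = 0 := by
    intro v w y z
    have h1 : (Module.finrank ℝ E : ℝ) - 2 ≠ 0 := by linarith
    have h2 : (Module.finrank ℝ E : ℝ) - 1 ≠ 0 := by linarith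
    rw [hA, hscal]
    simp only [kulkarniNomizu, hric]
    field_simp
    ring
  exact key v w y z

end Conformal

/-! ### Metrics of pointwise constant curvature -/

section PointwiseConstant

variable {E : Type*} [NormedAddCommGroup E] [NormedSpace ℝ E]
  {M : Type*} [TopologicalSpace M] [ChartedSpace E M]
  {g : BilinField 𝓘(ℝ, E) M}

/-- The curvature at each point `x` is `ρ x` times that of a space of constant curvature one. -/
def HasPointwiseConstantCurvature (g : BilinField 𝓘(ℝ, E) M) (ρ : M → ℝ) : Prop :=
  ∀ (x : M) (v w y z : E), riemann 𝓘(ℝ, E) g x v w y z = ρ x * halfSquare (modelForm g x) v w y z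

namespace HasPointwiseConstantCurvature

variable {ρ : M → ℝ}

theorem riemann_eq (h : HasPointwiseConstantCurvature g ρ) (x : M)
    (v w y z : TangentSpace 𝓘(ℝ, E) x) :
    riemann 𝓘(ℝ, E) g x v w y z =
      ρ x / 2 * kulkarniNomizu (metricFn 𝓘(ℝ, E) g x) (metricFn 𝓘(ℝ, E) g x) v w y z := by
  refine (h x v w y z).trans ?_
  have := kulkarniNomizu_self (modelForm g x) v w y z
  change _ = ρ x / 2 *
    kulkarniNomizu (fun v w => modelForm g x v w) (fun v w => modelForm g x v w) v w y z
  rw [this]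
  ring

theorem isConstantCurvature {c : ℝ} (h : HasPointwiseConstantCurvature g fun _ => c) :
    IsConstantCurvature 𝓘(ℝ, E) g :=
  ⟨c, fun x v w y z => (h.riemann_eq x v w y z).trans (by ring)⟩

variable [IsManifold 𝓘(ℝ, E) ∞ M]

theorem oneForm_isSmooth_zero : OneForm.IsSmooth 𝓘(ℝ, E) (fun _ : M => 0) :=
  Bundle.contMDiff_zeroSection ℝ fun x : M => TangentSpace 𝓘(ℝ, E) x →L[ℝ] ℝ

theorem isQuasiConstantCurvature (h : HasPointwiseConstantCurvature g ρ)
    (hρ : ContMDiff 𝓘(ℝ, E) 𝓘(ℝ, ℝ) ∞ ρ) : IsQuasiConstantCurvature 𝓘(ℝ, E) g :=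
  ⟨fun x => ρ x / 2, fun _ => 0, fun _ => 0, hρ.div_const 2, contMDiff_const,
    oneForm_isSmooth_zero, fun x v w y z => (h.riemann_eq x v w y z).trans (by ring)⟩

theorem localRiemann_self (h : HasPointwiseConstantCurvature g ρ) (x : M) (v w y z : E) :
    localRiemann (inChart 𝓘(ℝ, E) g x) (extChartAt 𝓘(ℝ, E) x x) v w y z =
      ρ x * halfSquare (inChart 𝓘(ℝ, E) g x (extChartAt 𝓘(ℝ, E) x x)) v w y z := by
  rw [inChart_self]
  exact h x v w y z

variable [FiniteDimensional ℝ E]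

theorem localRiemann_eq (h : HasPointwiseConstantCurvature g ρ)
    (hg : IsSemiRiemannianMetric 𝓘(ℝ, E) g) {x : M} {u : E}
    (hu : u ∈ (extChartAt 𝓘(ℝ, E) x).target) (v w y z : E) :
    localRiemann (inChart 𝓘(ℝ, E) g x) u v w y z =
      ρ ((extChartAt 𝓘(ℝ, E) x).symm u) * halfSquare (inChart 𝓘(ℝ, E) g x u) v w y z := by
  rw [localRiemann_inChart hg hu]
  exact h _ _ _ _ _

/-- No regularity of ρ is assumed: locally it is a smooth curvature component divided by a
nonvanishing component of ½ g ∧ g. -/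
theorem contDiffAt_comp_symm (h : HasPointwiseConstantCurvature g ρ)
    (hg : IsSemiRiemannianMetric 𝓘(ℝ, E) g) (hn : 2 ≤ Module.finrank ℝ E) {x : M} {u : E}
    (hu : u ∈ (extChartAt 𝓘(ℝ, E) x).target) :
    ContDiffAt ℝ ∞ (fun u => ρ ((extChartAt 𝓘(ℝ, E) x).symm u)) u := by
  have hm := hg.isMetricOn x
  obtain ⟨v, w, y, z, hK⟩ := exists_halfSquare_ne_zero hn (hm.invertible u hu)
  have hs : ∀ v w : E, ContDiffAt ℝ ∞ (fun u => inChart 𝓘(ℝ, E) g x u v w) u := fun v w =>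
    ((hm.contDiffAt u hu).clm_apply contDiffAt_const).clm_apply contDiffAt_const
  have hKs : ContDiffAt ℝ ∞ (fun u => halfSquare (inChart 𝓘(ℝ, E) g x u) v w y z) u :=
    ((hs v z).mul (hs w y)).sub ((hs v y).mul (hs w z))
  refine ((hm.contDiffAt_localRiemann hu v w y z).div hKs hK).congr_of_eventuallyEq ?_
  filter_upwards [hm.mem_nhds hu, hKs.continuousAt.eventually_ne hK] with t ht htK
  rw [Pi.div_apply, h.localRiemann_eq hg ht, mul_div_cancel_right₀ _ htK]

theorem contMDiff (h : HasPointwiseConstantCurvature g ρ)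
    (hg : IsSemiRiemannianMetric 𝓘(ℝ, E) g) (hn : 2 ≤ Module.finrank ℝ E) :
    ContMDiff 𝓘(ℝ, E) 𝓘(ℝ, ℝ) ∞ ρ := by
  intro x
  have h1 : ContMDiffAt 𝓘(ℝ, E) 𝓘(ℝ, ℝ) ∞ (fun u => ρ ((extChartAt 𝓘(ℝ, E) x).symm u))
      (extChartAt 𝓘(ℝ, E) x x) :=
    (h.contDiffAt_comp_symm hg hn (mem_extChartAt_target x)).contMDiffAt
  refine (h1.comp x contMDiffAt_extChartAt).congr_of_eventuallyEq ?_
  filter_upwards [extChartAt_source_mem_nhds (I := 𝓘(ℝ, E)) x] with y hy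
  simp only [Function.comp_apply, (extChartAt 𝓘(ℝ, E) x).left_inv hy]

/-- Schur's lemma. -/
theorem eq_const [ConnectedSpace M] (h : HasPointwiseConstantCurvature g ρ)
    (hg : IsSemiRiemannianMetric 𝓘(ℝ, E) g) (hn : 3 ≤ Module.finrank ℝ E) (x y : M) :
    ρ x = ρ y := by
  have hloc : IsLocallyConstant ρ := by
    refine (IsLocallyConstant.iff_eventually_eq ρ).2 fun x => ?_
    have hm := hg.isMetricOn x
    -- The chart image need not be connected, so the vanishing of dρ is integrated over a ball
    -- around the centre. Connectedness of M makes the local constancy global.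
    obtain ⟨ε, hε, hball⟩ := Metric.isOpen_iff.1 hm.isOpen _ (mem_extChartAt_target x)
    have hd : ∀ u ∈ (extChartAt 𝓘(ℝ, E) x).target,
        DifferentiableAt ℝ (fun u => ρ ((extChartAt 𝓘(ℝ, E) x).symm u)) u := fun u hu =>
      (h.contDiffAt_comp_symm hg (by omega) hu).differentiableAt (by simp)
    have hzero : ∀ u ∈ (extChartAt 𝓘(ℝ, E) x).target,
        fderiv ℝ (fun u => ρ ((extChartAt 𝓘(ℝ, E) x).symm u)) u = 0 := fun u hu =>
      fderiv_eq_zero_of_pointwise_constant hn hm hu (hd u hu) fun t ht v w z =>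
        curvatureOperator_of_halfSquare (hm.invertible t ht) (h.localRiemann_eq hg ht) v w z
    have hmem : (extChartAt 𝓘(ℝ, E) x) ⁻¹' Metric.ball (extChartAt 𝓘(ℝ, E) x x) ε ∈ nhds x :=
      (continuousAt_extChartAt x).preimage_mem_nhds (Metric.ball_mem_nhds _ hε)
    filter_upwards [hmem, extChartAt_source_mem_nhds (I := 𝓘(ℝ, E)) x] with y hy hys
    have := Metric.isOpen_ball.is_const_of_fderiv_eq_zero (𝕜 := ℝ)
      (convex_ball (extChartAt 𝓘(ℝ, E) x x) ε).isPreconnected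
      (fun u hu => (hd u (hball hu)).differentiableWithinAt) (fun u hu => hzero u (hball hu))
      hy (Metric.mem_ball_self hε)
    beta_reduce at this
    rwa [(extChartAt 𝓘(ℝ, E) x).left_inv hys, extChartAt_to_inv] at this
  exact hloc.apply_eq_of_preconnectedSpace x y

theorem ricci_eq (h : HasPointwiseConstantCurvature g ρ)
    (hg : IsSemiRiemannianMetric 𝓘(ℝ, E) g) (x : M) (v w : E) :
    ricci 𝓘(ℝ, E) g x v w = ((Module.finrank ℝ E : ℝ) - 1) * ρ x * modelForm g x v w := by
  change localRicci (inChart 𝓘(ℝ, E) g x) (extChartAt 𝓘(ℝ, E) x x) v w = _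
  rw [localRicci_of_halfSquare (isInvertible_inChart_self hg x) (h.localRiemann_self x),
    inChart_self]

theorem isEinstein (h : HasPointwiseConstantCurvature g ρ)
    (hg : IsSemiRiemannianMetric 𝓘(ℝ, E) g) (hn : 1 ≤ Module.finrank ℝ E) :
    IsEinstein 𝓘(ℝ, E) g := by
  intro x v w
  have hn' : (1 : ℝ) ≤ Module.finrank ℝ E := by exact_mod_cast hn
  refine (h.ricci_eq hg x v w).trans ?_
  rw [scalarCurvature, localScalar_of_halfSquare (isInvertible_inChart_self hg x)
    (h.localRiemann_self x)]
  change _ = _ * modelForm g x v w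
  field_simp

theorem isConformallyFlat (h : HasPointwiseConstantCurvature g ρ)
    (hg : IsSemiRiemannianMetric 𝓘(ℝ, E) g) : IsConformallyFlat 𝓘(ℝ, E) g :=
  isConformallyFlat_of_kulkarniNomizu hg fun x => ⟨(ρ x / 2) • toBilin (modelForm g x),
    fun v w y z => by rw [h x, halfSquare_eq_kulkarniNomizu]⟩

theorem isQuasiEinstein (h : HasPointwiseConstantCurvature g ρ)
    (hg : IsSemiRiemannianMetric 𝓘(ℝ, E) g) (hρ : ContMDiff 𝓘(ℝ, E) 𝓘(ℝ, ℝ) ∞ ρ) :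
    IsQuasiEinstein 𝓘(ℝ, E) g :=
  ⟨fun x => ((Module.finrank ℝ E : ℝ) - 1) * ρ x, fun _ => 0, fun _ => 0,
    contMDiff_const.mul hρ, contMDiff_const, oneForm_isSmooth_zero, fun x v w =>
      (h.ricci_eq hg x v w).trans (by
        change _ = _ * modelForm g x v w + _
        ring)⟩

end HasPointwiseConstantCurvature

end PointwiseConstant

/-! ### Comparing warped product curvature with g ∧ A -/

section ConformallyFlatWarped

variable {E : Type*} [NormedAddCommGroup E] [NormedSpace ℝ E]
  {E' : Type*} [NormedAddCommGroup E'] [NormedSpace ℝ E']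

/-- The bilinear form of the base whose product with the fiber metric gives the mixed components
of the curvature of a warped product. -/
def mixedForm (GB : E → E →L[ℝ] E →L[ℝ] ℝ) (h : E → ℝ) (u : E) : E →L[ℝ] E →L[ℝ] ℝ :=
  -(GB u ∘L (fderiv ℝ (warpGradient GB h) u + (christoffel GB u).flip (warpGradient GB h u)
    - (warpForm h u).smulRight (warpGradient GB h u)))

/-- For a metric and a smooth nonvanishing h, this is -½(∇dh - dh ⊗ dh/(2h)) = hT, the first two
terms inside `GB u` being the covariant derivative of half the gradient. -/
theorem mixedForm_apply (GB : E → E →L[ℝ] E →L[ℝ] ℝ) (h : E → ℝ) (u x z : E) :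
    mixedForm GB h u x z =
      -GB u (fderiv ℝ (warpGradient GB h) u x + christoffel GB u x (warpGradient GB h u)
        - warpForm h u x • warpGradient GB h u) z := rfl

namespace IsLocalWarpedProduct

variable {GB : E → E →L[ℝ] E →L[ℝ] ℝ} {U : Set E} {h : E → ℝ}
  {GF : E' → E' →L[ℝ] E' →L[ℝ] ℝ} {U' : Set E'}
  {G : E × E' → E × E' →L[ℝ] E × E' →L[ℝ] ℝ} {p : E × E'}

variable [FiniteDimensional ℝ E] [FiniteDimensional ℝ E']

/-- If the curvature of a warped product is `g ∧ A`, then the fiber has pointwise constant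
curvature, which is determined by the base as soon as the base has dimension at least two. -/
theorem exists_of_kulkarniNomizu (H : IsLocalWarpedProduct GB U h GF U' G) (hp : p ∈ U ×ˢ U')
    (hE : 1 ≤ Module.finrank ℝ E) (hE' : 1 ≤ Module.finrank ℝ E') (A : E × E' →ₗ[ℝ] E × E' →ₗ[ℝ] ℝ)
    (hR : ∀ v w y z, localRiemann G p v w y z =
      kulkarniNomizu (fun v w => G p v w) (fun v w => A v w) v w y z) :
    ∃ σ : ℝ,
      (∀ v w y z, localRiemann GF p.2 v w y z =
        (warpForm h p.1 (warpGradient GB h p.1) + 2 * σ) * halfSquare (GF p.2) v w y z) ∧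
      (∀ v w y z, h p.1 * localRiemann GB p.1 v w y z =
        kulkarniNomizu (fun v w => GB p.1 v w) (fun v w => mixedForm GB h p.1 v w) v w y z
          - 2 * σ * halfSquare (GB p.1) v w y z) := by
  have h0 := H.warp_ne_zero _ hp.1
  have hmix : ∀ x z v w, mixedForm GB h p.1 x z * GF p.2 v w =
      GB p.1 x z * A (0, v) (0, w) + h p.1 * GF p.2 v w * A (x, 0) (z, 0) := by
    intro x z v w
    have := hR (x, 0) (0, v) (0, w) (z, 0)
    rw [H.localRiemann_mixed hp] at this
    rw [mixedForm_apply, this]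
    simp [kulkarniNomizu, H.eq p hp]
  obtain ⟨x₀, z₀, hr⟩ := exists_apply_ne_zero hE (H.base.invertible _ hp.1)
  obtain ⟨v₁, w₁, hvw⟩ := exists_apply_ne_zero hE' (H.fiber.invertible _ hp.2)
  -- The relation `hmix` at one pair with gB(x₀,z₀) ≠ 0 is solved for A on fiber vectors, which is
  -- thereby a multiple of gF.
  set σ := (mixedForm GB h p.1 x₀ z₀ - h p.1 * A (x₀, 0) (z₀, 0)) / GB p.1 x₀ z₀ with hσ
  have hfib : ∀ v w, A (0, v) (0, w) = σ * GF p.2 v w := by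
    intro v w
    have := hmix x₀ z₀ v w
    rw [hσ]
    field_simp
    linarith
  have hRF : ∀ v w y z, localRiemann GF p.2 v w y z =
      (warpForm h p.1 (warpGradient GB h p.1) + 2 * σ) * halfSquare (GF p.2) v w y z := by
    intro v w y z
    have := hR (0, v) (0, w) (0, y) (0, z)
    rw [H.localRiemann_fiber hp] at this
    simp only [kulkarniNomizu, H.eq p hp, hfib, map_zero, zero_add] at this
    refine mul_left_cancel₀ h0 ?_
    rw [halfSquare]
    linear_combination this
  refine ⟨σ, hRF, fun v w y z => ?_⟩
  -- Now that A is known on the fiber, gF(v₁,w₁) ≠ 0 can be cancelled from `hmix`.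
  have hbase : ∀ x z, h p.1 * A (x, 0) (z, 0) = mixedForm GB h p.1 x z - σ * GB p.1 x z := by
    intro x z
    have := hmix x z v₁ w₁
    rw [hfib] at this
    refine mul_right_cancel₀ hvw ?_
    linear_combination -this
  have := hR (v, 0) (w, 0) (y, 0) (z, 0)
  rw [H.localRiemann_base hp] at this
  rw [this]
  simp only [kulkarniNomizu, H.eq p hp, map_zero, mul_zero, add_zero, halfSquare]
  linear_combination GB p.1 v z * hbase w y + GB p.1 w y * hbase v z
    - GB p.1 v y * hbase w z - GB p.1 w z * hbase v y

end IsLocalWarpedProduct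

end ConformallyFlatWarped

/-! ### Warped products of manifolds in product charts -/

section WarpedChart

variable {E : Type*} [NormedAddCommGroup E] [NormedSpace ℝ E]
  {B : Type*} [TopologicalSpace B] [ChartedSpace E B]
  {E' : Type*} [NormedAddCommGroup E'] [NormedSpace ℝ E']
  {F : Type*} [TopologicalSpace F] [ChartedSpace E' F]

theorem extChartAt_prod_symm_apply (x : B × F) (p : E × E') :
    (extChartAt (𝓘(ℝ, E).prod 𝓘(ℝ, E')) x).symm p =
      ((extChartAt 𝓘(ℝ, E) x.1).symm p.1, (extChartAt 𝓘(ℝ, E') x.2).symm p.2) := by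
  rw [extChartAt_prod]
  rfl

/-- The warped product metric, with the tangent spaces identified with the model space. -/
theorem warpedProduct_apply (gB : BilinField 𝓘(ℝ, E) B) (f : B → ℝ)
    (gF : BilinField 𝓘(ℝ, E') F) (y : B × F) (V W : E × E') :
    (warpedProduct 𝓘(ℝ, E) 𝓘(ℝ, E') gB f gF y : E × E' →L[ℝ] E × E' →L[ℝ] ℝ) V W =
      modelForm gB y.1 V.1 W.1 + f y.1 * modelForm gF y.2 V.2 W.2 := by
  simp only [warpedProduct, mfderiv_fst, mfderiv_snd]
  rfl

/-- The derivative of the inverse of the preferred chart of a product. -/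
def prodChartSymmDeriv (x : B × F) (p : E × E') : E × E' →L[ℝ] E × E' :=
  mfderiv 𝓘(ℝ, E × E') (𝓘(ℝ, E).prod 𝓘(ℝ, E')) (extChartAt (𝓘(ℝ, E).prod 𝓘(ℝ, E')) x).symm p

variable [IsManifold 𝓘(ℝ, E) ∞ B] [IsManifold 𝓘(ℝ, E') ∞ F]

theorem prodChartSymmDeriv_apply (x : B × F) {p : E × E'}
    (hp : p ∈ (extChartAt 𝓘(ℝ, E) x.1).target ×ˢ (extChartAt 𝓘(ℝ, E') x.2).target)
    (V : E × E') :
    prodChartSymmDeriv x p V =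
      (chartSymmDeriv x.1 p.1 V.1, chartSymmDeriv x.2 p.2 V.2) := by
  have h1 := (mdifferentiableAt_chart_symm hp.1).hasMFDerivAt.comp p
    (hasFDerivAt_fst (𝕜 := ℝ) (p := p)).hasMFDerivAt
  have h2 := (mdifferentiableAt_chart_symm hp.2).hasMFDerivAt.comp p
    (hasFDerivAt_snd (𝕜 := ℝ) (p := p)).hasMFDerivAt
  have h3 := (h1.prodMk h2).mfderiv
  have e : ((extChartAt (𝓘(ℝ, E).prod 𝓘(ℝ, E')) x).symm : E × E' → B × F) =
      fun p => (((extChartAt 𝓘(ℝ, E) x.1).symm ∘ Prod.fst) p,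
        ((extChartAt 𝓘(ℝ, E') x.2).symm ∘ Prod.snd) p) :=
    funext fun p => extChartAt_prod_symm_apply x p
  rw [prodChartSymmDeriv, e]
  exact congrArg (fun l : E × E' →L[ℝ] E × E' => l V) h3

theorem inChart_warpedProduct (gB : BilinField 𝓘(ℝ, E) B) (f : B → ℝ)
    (gF : BilinField 𝓘(ℝ, E') F) (x : B × F) {p : E × E'}
    (hp : p ∈ (extChartAt 𝓘(ℝ, E) x.1).target ×ˢ (extChartAt 𝓘(ℝ, E') x.2).target)
    (V W : E × E') :
    inChart (𝓘(ℝ, E).prod 𝓘(ℝ, E')) (warpedProduct 𝓘(ℝ, E) 𝓘(ℝ, E') gB f gF) x p V W =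
      inChart 𝓘(ℝ, E) gB x.1 p.1 V.1 W.1
        + f ((extChartAt 𝓘(ℝ, E) x.1).symm p.1) * inChart 𝓘(ℝ, E') gF x.2 p.2 V.2 W.2 := by
  refine (warpedProduct_apply gB f gF ((extChartAt (𝓘(ℝ, E).prod 𝓘(ℝ, E')) x).symm p)
    (prodChartSymmDeriv x p V) (prodChartSymmDeriv x p W)).trans ?_
  rw [prodChartSymmDeriv_apply x hp, prodChartSymmDeriv_apply x hp, extChartAt_prod_symm_apply]
  rfl

variable [FiniteDimensional ℝ E] [FiniteDimensional ℝ E'] {gB : BilinField 𝓘(ℝ, E) B}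
  {gF : BilinField 𝓘(ℝ, E') F} {f : B → ℝ}

theorem isLocalWarpedProduct_inChart (hgB : IsSemiRiemannianMetric 𝓘(ℝ, E) gB)
    (hgF : IsSemiRiemannianMetric 𝓘(ℝ, E') gF) (hf : ContMDiff 𝓘(ℝ, E) 𝓘(ℝ, ℝ) ∞ f)
    (hf_pos : ∀ x, 0 < f x) (x : B × F) :
    IsLocalWarpedProduct (inChart 𝓘(ℝ, E) gB x.1) (extChartAt 𝓘(ℝ, E) x.1).target
      (fun u => f ((extChartAt 𝓘(ℝ, E) x.1).symm u)) (inChart 𝓘(ℝ, E') gF x.2)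
      (extChartAt 𝓘(ℝ, E') x.2).target
      (inChart (𝓘(ℝ, E).prod 𝓘(ℝ, E')) (warpedProduct 𝓘(ℝ, E) 𝓘(ℝ, E') gB f gF) x) where
  base := hgB.isMetricOn x.1
  fiber := hgF.isMetricOn x.2
  contDiffAt_warp u hu :=
    contMDiffAt_iff_contDiffAt.1 (hf.contMDiffAt.comp u (contMDiffAt_chart_symm hu))
  warp_ne_zero _ _ := (hf_pos _).ne'
  eq _ hp V W := inChart_warpedProduct gB f gF x hp V W

/-- The curvature of a conformally flat manifold is `g ∧ A`, with `A` the Schouten tensor. -/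
theorem exists_kulkarniNomizu_of_isConformallyFlat
    (hn : 3 ≤ Module.finrank ℝ E + Module.finrank ℝ E')
    (hM : IsConformallyFlat (𝓘(ℝ, E).prod 𝓘(ℝ, E'))
      (warpedProduct 𝓘(ℝ, E) 𝓘(ℝ, E') gB f gF)) (x : B × F) :
    ∃ A : E × E' →ₗ[ℝ] E × E' →ₗ[ℝ] ℝ, ∀ v w y z,
      localRiemann (inChart (𝓘(ℝ, E).prod 𝓘(ℝ, E')) (warpedProduct 𝓘(ℝ, E) 𝓘(ℝ, E') gB f gF) x)
        (extChartAt 𝓘(ℝ, E) x.1 x.1, extChartAt 𝓘(ℝ, E') x.2 x.2) v w y z =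
      kulkarniNomizu (fun v w => inChart (𝓘(ℝ, E).prod 𝓘(ℝ, E'))
        (warpedProduct 𝓘(ℝ, E) 𝓘(ℝ, E') gB f gF) x
        (extChartAt 𝓘(ℝ, E) x.1 x.1, extChartAt 𝓘(ℝ, E') x.2 x.2) v w)
        (fun v w => A v w) v w y z := by
  set G := inChart (𝓘(ℝ, E).prod 𝓘(ℝ, E')) (warpedProduct 𝓘(ℝ, E) 𝓘(ℝ, E') gB f gF) x with hG
  set p : E × E' := (extChartAt 𝓘(ℝ, E) x.1 x.1, extChartAt 𝓘(ℝ, E') x.2 x.2) with hp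
  have hcenter : (extChartAt (𝓘(ℝ, E).prod 𝓘(ℝ, E')) x x : E × E') = p := by
    rw [extChartAt_prod]
    rfl
  have hmetric : ∀ V W : E × E',
      (warpedProduct 𝓘(ℝ, E) 𝓘(ℝ, E') gB f gF x : E × E' →L[ℝ] E × E' →L[ℝ] ℝ) V W =
        G p V W := by
    intro V W
    rw [warpedProduct_apply, hG, inChart_warpedProduct gB f gF x
      ⟨mem_extChartAt_target x.1, mem_extChartAt_target x.2⟩]
    simp only [hp, inChart_self, extChartAt_to_inv]
  have hC : ∀ v w y z : E × E', localRiemann G p v w y z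
      - 1 / ((Module.finrank ℝ (E × E') : ℝ) - 2) * kulkarniNomizu (fun v w => G p v w)
        (fun v w => localRicci G p v w) v w y z
      + localScalar G p
        / (2 * ((Module.finrank ℝ (E × E') : ℝ) - 1) * ((Module.finrank ℝ (E × E') : ℝ) - 2))
        * kulkarniNomizu (fun v w => G p v w) (fun v w => G p v w) v w y z = 0 := by
    intro v w y z
    have := hM (by rw [Module.finrank_prod]; exact hn) x v w y z
    rw [← hcenter]
    rw [← hcenter] at hmetric
    simp only [← hmetric]
    exact this
  refine ⟨(1 / ((Module.finrank ℝ (E × E') : ℝ) - 2)) • localRicci G p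
    - (localScalar G p / (2 * ((Module.finrank ℝ (E × E') : ℝ) - 1)
      * ((Module.finrank ℝ (E × E') : ℝ) - 2))) • toBilin (G p), fun v w y z => ?_⟩
  have := hC v w y z
  simp only [kulkarniNomizu, LinearMap.sub_apply, LinearMap.smul_apply, smul_eq_mul,
    toBilin_apply] at this ⊢
  linear_combination this

end WarpedChart

/-! ### Curvature of the base and the fiber -/

section Consequences

variable {E : Type*} [NormedAddCommGroup E] [NormedSpace ℝ E] [FiniteDimensional ℝ E]
  {B : Type*} [TopologicalSpace B] [ChartedSpace E B] [IsManifold 𝓘(ℝ, E) ∞ B]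
  {E' : Type*} [NormedAddCommGroup E'] [NormedSpace ℝ E'] [FiniteDimensional ℝ E']
  {F : Type*} [TopologicalSpace F] [ChartedSpace E' F] [IsManifold 𝓘(ℝ, E') ∞ F]
  {gB : BilinField 𝓘(ℝ, E) B} {gF : BilinField 𝓘(ℝ, E') F} {f : B → ℝ}

/-- The curvatures of the base and the fiber of a conformally flat warped product. -/
theorem curvature_of_isConformallyFlat_warpedProduct (hp : 1 ≤ Module.finrank ℝ E)
    (hq : 1 ≤ Module.finrank ℝ E') (hn : 3 ≤ Module.finrank ℝ E + Module.finrank ℝ E')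
    (hgB : IsSemiRiemannianMetric 𝓘(ℝ, E) gB) (hgF : IsSemiRiemannianMetric 𝓘(ℝ, E') gF)
    (hf : ContMDiff 𝓘(ℝ, E) 𝓘(ℝ, ℝ) ∞ f) (hf_pos : ∀ x, 0 < f x)
    (hM : IsConformallyFlat (𝓘(ℝ, E).prod 𝓘(ℝ, E'))
      (warpedProduct 𝓘(ℝ, E) 𝓘(ℝ, E') gB f gF)) (x : B) :
    ∃ (ν : ℝ) (τ : E →L[ℝ] E →L[ℝ] ℝ), ∀ x' : F, ∃ σ : ℝ,
      (∀ v w y z : E', riemann 𝓘(ℝ, E') gF x' v w y z =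
        (ν + 2 * σ) * halfSquare (modelForm gF x') v w y z) ∧
      (∀ v w y z : E, f x * riemann 𝓘(ℝ, E) gB x v w y z =
        kulkarniNomizu (fun v w => modelForm gB x v w) (fun v w => τ v w) v w y z
          - 2 * σ * halfSquare (modelForm gB x) v w y z) := by
  let c : E := extChartAt 𝓘(ℝ, E) x x
  let h : E → ℝ := fun u => f ((extChartAt 𝓘(ℝ, E) x).symm u)
  let GB := inChart 𝓘(ℝ, E) gB x
  -- Both witnesses depend on the base point alone and are fixed before x'; only σ may vary along
  -- the fiber.
  refine ⟨warpForm h c (warpGradient GB h c), mixedForm GB h c, fun x' => ?_⟩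
  obtain ⟨A, hA⟩ := exists_kulkarniNomizu_of_isConformallyFlat hn hM (x, x')
  obtain ⟨σ, h1, h2⟩ := (isLocalWarpedProduct_inChart hgB hgF hf hf_pos (x, x')).exists_of_kulkarniNomizu
    ⟨mem_extChartAt_target x, mem_extChartAt_target x'⟩ hp hq A hA
  simp only [inChart_self, extChartAt_to_inv] at h1 h2
  exact ⟨σ, h1, h2⟩

/-- The base of a conformally flat warped product is conformally flat. -/
theorem isConformallyFlat_base [Nonempty F] (hp : 1 ≤ Module.finrank ℝ E)
    (hq : 1 ≤ Module.finrank ℝ E') (hn : 3 ≤ Module.finrank ℝ E + Module.finrank ℝ E')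
    (hgB : IsSemiRiemannianMetric 𝓘(ℝ, E) gB) (hgF : IsSemiRiemannianMetric 𝓘(ℝ, E') gF)
    (hf : ContMDiff 𝓘(ℝ, E) 𝓘(ℝ, ℝ) ∞ f) (hf_pos : ∀ x, 0 < f x)
    (hM : IsConformallyFlat (𝓘(ℝ, E).prod 𝓘(ℝ, E'))
      (warpedProduct 𝓘(ℝ, E) 𝓘(ℝ, E') gB f gF)) : IsConformallyFlat 𝓘(ℝ, E) gB := by
  refine isConformallyFlat_of_kulkarniNomizu hgB fun x => ?_
  obtain ⟨ν, τ, h⟩ :=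
    curvature_of_isConformallyFlat_warpedProduct hp hq hn hgB hgF hf hf_pos hM x
  obtain ⟨σ, -, h2⟩ := h (Classical.arbitrary F)
  -- The term 2σ · ½ g ∧ g is absorbed into g ∧ τ, giving f R = g ∧ (τ - σ g).
  refine ⟨(f x)⁻¹ • (toBilin τ - σ • toBilin (modelForm gB x)), fun v w y z => ?_⟩
  have hfx := (hf_pos x).ne'
  refine mul_left_cancel₀ hfx ?_
  rw [h2]
  simp only [kulkarniNomizu, halfSquare, LinearMap.smul_apply, LinearMap.sub_apply,
    toBilin_apply, smul_eq_mul]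
  field_simp
  ring

/-- The fiber of a conformally flat warped product has pointwise constant curvature `ρ`, where
`ρ` is smooth, and `ρ` is constant except when the base is a curve and the fiber a surface. -/
theorem hasPointwiseConstantCurvature_fiber [Nonempty B] [ConnectedSpace F]
    (hp : 1 ≤ Module.finrank ℝ E)
    (hq : 1 ≤ Module.finrank ℝ E') (hn : 3 ≤ Module.finrank ℝ E + Module.finrank ℝ E')
    (hgB : IsSemiRiemannianMetric 𝓘(ℝ, E) gB) (hgF : IsSemiRiemannianMetric 𝓘(ℝ, E') gF)
    (hf : ContMDiff 𝓘(ℝ, E) 𝓘(ℝ, ℝ) ∞ f) (hf_pos : ∀ x, 0 < f x)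
    (hM : IsConformallyFlat (𝓘(ℝ, E).prod 𝓘(ℝ, E'))
      (warpedProduct 𝓘(ℝ, E) 𝓘(ℝ, E') gB f gF)) :
    ∃ ρ : F → ℝ, HasPointwiseConstantCurvature gF ρ ∧ ContMDiff 𝓘(ℝ, E') 𝓘(ℝ, ℝ) ∞ ρ ∧
      (¬ (Module.finrank ℝ E = 1 ∧ Module.finrank ℝ E' = 2) → ∀ x y, ρ x = ρ y) := by
  let x : B := Classical.arbitrary B
  obtain ⟨ν, τ, h⟩ :=
    curvature_of_isConformallyFlat_warpedProduct hp hq hn hgB hgF hf hf_pos hM x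
  choose σ hfib hbase using h
  have hρ : HasPointwiseConstantCurvature gF fun x' => ν + 2 * σ x' := hfib
  rcases Nat.lt_or_ge (Module.finrank ℝ E') 2 with hq1 | hq2
  -- On a curve ½ g ∧ g = 0, so any ρ fits; zero is smooth and constant.
  · refine ⟨fun _ => 0, fun x' v w y z => ?_, contMDiff_const, fun _ _ _ => rfl⟩
    rw [hfib, halfSquare_eq_zero (by omega), mul_zero, mul_zero]
  · refine ⟨_, hρ, hρ.contMDiff hgF hq2, fun hpq y y' => ?_⟩
    rcases Nat.lt_or_ge (Module.finrank ℝ E') 3 with hq3 | hq3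
    -- Here q = 2, hence p ≥ 2 and ½ gB ∧ gB ≠ 0. The curvature of the base at x does not depend on
    -- the fiber point, so `hbase` at y and y' gives equal values of σ.
    · obtain ⟨v, w, t, z, hK⟩ := exists_halfSquare_ne_zero (by omega)
        (isInvertible_inChart_self hgB x)
      rw [inChart_self] at hK
      have h1 := (hbase y v w t z).symm.trans (hbase y' v w t z)
      have h2 : σ y = σ y' := mul_right_cancel₀ hK (by linarith)
      simp only [h2]
    · exact hρ.eq_const hgF hq3 y y'

namespace HasPointwiseConstantCurvature

variable {ρ : F → ℝ}

/-- A pointwise constant curvature metric, quasi-Einstein in the strict sense, is of quasi-constant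
curvature in the strict sense, with the same `1`-form. -/
theorem isProperQuasiConstantCurvature (h : HasPointwiseConstantCurvature gF ρ)
    (hgF : IsSemiRiemannianMetric 𝓘(ℝ, E') gF) (hρ : ContMDiff 𝓘(ℝ, E') 𝓘(ℝ, ℝ) ∞ ρ)
    (hq : 3 ≤ Module.finrank ℝ E') (hE : IsProperQuasiEinstein 𝓘(ℝ, E') gF) :
    IsProperQuasiConstantCurvature 𝓘(ℝ, E') gF := by
  obtain ⟨α, β, η, hα, hβ, hη, hβ0, hη0, heq⟩ := hE
  have hq' : (3 : ℝ) ≤ Module.finrank ℝ E' := by exact_mod_cast hq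
  have h2 : (Module.finrank ℝ E' : ℝ) - 2 ≠ 0 := by linarith
  -- Multiplying (q-1)ρ g = α g + β η ⊗ η by g gives (q-1)ρ g ∧ g = α g ∧ g + β g ∧ (η ⊗ η).
  -- Subtracting (q/2)ρ g ∧ g leaves (q-2)(ρ/2) g ∧ g = (q-2)R on the left.
  refine ⟨fun x => (α x - (Module.finrank ℝ E' : ℝ) / 2 * ρ x) / ((Module.finrank ℝ E' : ℝ) - 2),
    fun x => β x / ((Module.finrank ℝ E' : ℝ) - 2), η,
    (hα.sub (contMDiff_const.mul hρ)).div_const _, hβ.div_const _, hη,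
    fun x => div_ne_zero (hβ0 x) h2, hη0, fun x v w y z => ?_⟩
  let l : E' →L[ℝ] ℝ := η x
  have hS : ∀ v w : E', ((Module.finrank ℝ E' : ℝ) - 1) * ρ x * modelForm gF x v w =
      α x * modelForm gF x v w + β x * (l v * l w) :=
    fun v w => (h.ricci_eq hgF x v w).symm.trans (heq x v w)
  have key : ∀ v w y z : E', ρ x * halfSquare (modelForm gF x) v w y z =
      (α x - (Module.finrank ℝ E' : ℝ) / 2 * ρ x) / ((Module.finrank ℝ E' : ℝ) - 2)
        * kulkarniNomizu (fun v w => modelForm gF x v w) (fun v w => modelForm gF x v w) v w y z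
      + β x / ((Module.finrank ℝ E' : ℝ) - 2)
        * kulkarniNomizu (fun v w => modelForm gF x v w) (fun v w => l v * l w) v w y z := by
    intro v w y z
    rw [kulkarniNomizu_self]
    simp only [kulkarniNomizu, halfSquare]
    field_simp
    linear_combination modelForm gF x v z * hS w y + modelForm gF x w y * hS v z
      - modelForm gF x v y * hS w z - modelForm gF x w z * hS v y
  exact (h x v w y z).trans (key v w y z)

/-- A pointwise constant curvature metric of strict quasi-constant curvature is strictly quasi-Einstein,
with the same `1`-form. -/
theorem isProperQuasiEinstein (h : HasPointwiseConstantCurvature gF ρ)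
    (hgF : IsSemiRiemannianMetric 𝓘(ℝ, E') gF) (hρ : ContMDiff 𝓘(ℝ, E') 𝓘(ℝ, ℝ) ∞ ρ)
    (hq : 3 ≤ Module.finrank ℝ E') (hC : IsProperQuasiConstantCurvature 𝓘(ℝ, E') gF) :
    IsProperQuasiEinstein 𝓘(ℝ, E') gF := by
  obtain ⟨a, b, η, ha, hb, hη, hb0, hη0, heq⟩ := hC
  have hq' : (3 : ℝ) ≤ Module.finrank ℝ E' := by exact_mod_cast hq
  have h2 : (Module.finrank ℝ E' : ℝ) - 2 ≠ 0 := by linarith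
  -- With A = a g + b η ⊗ η, S = (q-2)A + (tr A)g. The two expressions 2(q-1) tr A and q(q-1)ρ of
  -- the scalar curvature give tr A = qρ/2, so smoothness of the coefficient follows from that of ρ
  -- without computing the norm of η.
  refine ⟨fun x => ((Module.finrank ℝ E' : ℝ) - 2) * a x + (Module.finrank ℝ E' : ℝ) / 2 * ρ x,
    fun x => ((Module.finrank ℝ E' : ℝ) - 2) * b x, η,
    (contMDiff_const.mul ha).add (contMDiff_const.mul hρ), contMDiff_const.mul hb, hη,
    fun x => mul_ne_zero h2 (hb0 x), hη0, fun x v w => ?_⟩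
  let l : E' →L[ℝ] ℝ := η x
  have hG := isInvertible_inChart_self hgF x
  let A : E' →ₗ[ℝ] E' →ₗ[ℝ] ℝ := (a x) • toBilin (modelForm gF x)
    + (b x) • LinearMap.mk₂ ℝ (fun v w => l v * l w) (by intros; simp; ring)
      (by intros; simp; ring) (by intros; simp; ring) (by intros; simp; ring)
  have hA : ∀ v w, A v w = a x * modelForm gF x v w + b x * (l v * l w) := fun _ _ => rfl
  have hR : ∀ v w y z, localRiemann (inChart 𝓘(ℝ, E') gF x) (extChartAt 𝓘(ℝ, E') x x) v w y z =
      kulkarniNomizu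
        (fun v w => inChart 𝓘(ℝ, E') gF x (extChartAt 𝓘(ℝ, E') x x) v w)
        (fun v w => A v w) v w y z := by
    intro v w y z
    have h1 : localRiemann (inChart 𝓘(ℝ, E') gF x) (extChartAt 𝓘(ℝ, E') x x) v w y z =
        a x * kulkarniNomizu (fun v w => modelForm gF x v w) (fun v w => modelForm gF x v w)
          v w y z
        + b x * kulkarniNomizu (fun v w => modelForm gF x v w) (fun v w => l v * l w) v w y z :=
      heq x v w y z
    rw [h1, inChart_self]
    simp only [kulkarniNomizu, hA]
    ring
  have hric := localRicci_of_kulkarniNomizu hG A hR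
  have hscal := (localScalar_of_kulkarniNomizu hG A hR).symm.trans
    (localScalar_of_halfSquare hG (h.localRiemann_self x))
  set t := metricTrace (inChart 𝓘(ℝ, E') gF x (extChartAt 𝓘(ℝ, E') x x)) A
  have ht : t = (Module.finrank ℝ E' : ℝ) / 2 * ρ x := by
    have h1 : (Module.finrank ℝ E' : ℝ) - 1 ≠ 0 := by linarith
    refine mul_left_cancel₀ h1 ?_
    linarith
  rw [inChart_self, ht] at hric
  refine (congrArg (fun S => S v w) hric : ricci 𝓘(ℝ, E') gF x v w = _).trans ?_
  have key : ∀ v w : E', ((Module.finrank ℝ E' : ℝ) - 2) *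
        (a x * modelForm gF x v w + b x * (l v * l w))
        + (Module.finrank ℝ E' : ℝ) / 2 * ρ x * modelForm gF x v w =
      (((Module.finrank ℝ E' : ℝ) - 2) * a x + (Module.finrank ℝ E' : ℝ) / 2 * ρ x)
        * modelForm gF x v w + ((Module.finrank ℝ E' : ℝ) - 2) * b x * (l v * l w) := by
    intro v w
    ring
  exact key v w

end HasPointwiseConstantCurvature

end Consequences

end WarpedGeometry

end

/-! ### The main theorem -/

theorem mainTheorem6
    {E : Type*} [NormedAddCommGroup E] [NormedSpace ℝ E] [FiniteDimensional ℝ E]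
    {E' : Type*} [NormedAddCommGroup E'] [NormedSpace ℝ E'] [FiniteDimensional ℝ E']
    {B : Type*} [TopologicalSpace B] [ChartedSpace E B] [IsManifold 𝓘(ℝ, E) ∞ B]
    [ConnectedSpace B]
    {F : Type*} [TopologicalSpace F] [ChartedSpace E' F] [IsManifold 𝓘(ℝ, E') ∞ F]
    [ConnectedSpace F]
    (hp : 1 ≤ Module.finrank ℝ E) (hq : 1 ≤ Module.finrank ℝ E')
    (hn : 3 ≤ Module.finrank ℝ E + Module.finrank ℝ E')
    (gB : WarpedGeometry.BilinField 𝓘(ℝ, E) B)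
    (hgB : WarpedGeometry.IsSemiRiemannianMetric 𝓘(ℝ, E) gB)
    (gF : WarpedGeometry.BilinField 𝓘(ℝ, E') F)
    (hgF : WarpedGeometry.IsSemiRiemannianMetric 𝓘(ℝ, E') gF)
    (f : B → ℝ) (hf : ContMDiff 𝓘(ℝ, E) 𝓘(ℝ, ℝ) ∞ f) (hf_pos : ∀ x, 0 < f x)
    (hM : WarpedGeometry.IsConformallyFlat (𝓘(ℝ, E).prod 𝓘(ℝ, E'))
      (WarpedGeometry.warpedProduct 𝓘(ℝ, E) 𝓘(ℝ, E') gB f gF)) :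
    -- (i)
    WarpedGeometry.IsConformallyFlat 𝓘(ℝ, E') gF ∧
    -- (ii)
    (¬ (Module.finrank ℝ E = 1 ∧ Module.finrank ℝ E' = 2) →
      (WarpedGeometry.IsConstantCurvature 𝓘(ℝ, E') gF ↔
        WarpedGeometry.IsEinstein 𝓘(ℝ, E') gF)) ∧
    -- (iii)
    (WarpedGeometry.IsQuasiConstantCurvature 𝓘(ℝ, E') gF ↔
      WarpedGeometry.IsQuasiEinstein 𝓘(ℝ, E') gF) ∧
    (3 ≤ Module.finrank ℝ E' →
      (WarpedGeometry.IsProperQuasiConstantCurvature 𝓘(ℝ, E') gF ↔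
        WarpedGeometry.IsProperQuasiEinstein 𝓘(ℝ, E') gF)) ∧
    -- (iv)
    ((∃ a b c : B → ℝ, (∀ x, a x ≠ 0) ∧
        ∀ (x : B) (v w : TangentSpace 𝓘(ℝ, E) x),
          a x * WarpedGeometry.warpingTensor 𝓘(ℝ, E) gB f x v w + b x * gB x v w
            + c x * WarpedGeometry.ricci 𝓘(ℝ, E) gB x v w = 0) →
      WarpedGeometry.IsConformallyFlat 𝓘(ℝ, E) gB) := by
  obtain ⟨ρ, hρ, hsmooth, hconst⟩ :=
    WarpedGeometry.hasPointwiseConstantCurvature_fiber hp hq hn hgB hgF hf hf_pos hM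
  refine ⟨hρ.isConformallyFlat hgF, fun hpq => ?_, ?_, fun hq3 => ?_, fun _ => ?_⟩
  · obtain ⟨y⟩ := (inferInstance : Nonempty F)
    have hc : ρ = fun _ => ρ y := funext fun x => hconst hpq x y
    rw [hc] at hρ
    -- Both properties hold outright once ρ is constant.
    exact iff_of_true hρ.isConstantCurvature (hρ.isEinstein hgF hq)
  · exact iff_of_true (hρ.isQuasiConstantCurvature hsmooth) (hρ.isQuasiEinstein hgF hsmooth)
  · exact ⟨hρ.isProperQuasiEinstein hgF hsmooth hq3,
      hρ.isProperQuasiConstantCurvature hgF hsmooth hq3⟩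
  · exact WarpedGeometry.isConformallyFlat_base hp hq hn hgB hgF hf hf_pos hM
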